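/- Let $P$ be a regular pentagon with horizontal base and apex at the top, and label its sides, counterclockwise from the base, by $3,5,2,4,1$ (the labels are read modulo $5$). Let $-P$ be its image under a central symmetry, with the corresponding sides carrying the same labels. The double pentagon is the flat surface obtained from $P$ and $-P$ by gluing every side of $P$ to the (parallel) side of $-P$ with the same label by a parallel translation. A linear trajectory on it is a complete unit-speed straight line with a constant direction, avoiding the cone point; if it is periodic, its length is its least positive period, and its symbolic orbit is the cyclic word of the labels of the sides consecutively crossed during one period. The directions, considered up to sign, are divided into five closed sectors: sector $m$ consists of the directions that make an angle of at most $\pi/10$ with the normal to the side $m$. For a periodic trajectory with direction in sector $3$, let $(c,d,e,f)$ be the numbers of occurrences of the pairs of consecutive symbols $43,\ 41,\ 25,\ 23$, respectively, in its symbolic orbit; for a direction in sector $m$, use the pairs obtained from these by adding $m-3$ modulo $5$ to all symbols. Consider a periodic linear trajectory on the double pentagon with length $L$ and count vector $(c,d,e,f)$, starting in one of the two pentagons at a point $z$ in the direction $v$. Then the billiard trajectory in that regular pentagon, starting from the same point $z$ in the same direction $v$, never hits a vertex and is also periodic, and its length is $$\begin{cases} L, & \text{if } (c-f)+2(e-d)\equiv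 0 \bmod 5,\\ 5L, & \text{if } (c-f)+2(e-d)\not\equiv 0 \bmod 5.\end{cases}$$ Here the length of a periodic billiard trajectory is its least period containing an even number of reflections (if the trajectory already closes up after an odd number of reflections, it is traversed twice). -/

import Mathlib

open Filter Topology

noncomputable section

namespace Pentagon

/-- The vertices of a regular pentagon of circumradius `1` with an apex at the top and a horizontal
base; the labels `1, 2, 3, 4, 5 = 0` are elements of `ZMod 5`. The vertex `V j` is the one opposite
to the side with label `j`. Counterclockwise from the apex the vertices are
`V 3, V 5, V 2, V 4, V 1`. -/
def V (j : ZMod 5) : ℂ :=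
  Complex.exp (((Real.pi / 2 + 6 * Real.pi * ((j.val : ℝ) - 3) / 5 : ℝ) : ℂ) * Complex.I)

/-- The vertices of the two pentagons: those of `P = table 1`, and those of its centrally symmetric
copy `-P = table (-1)`. -/
def vertex (ε : ℤˣ) (j : ZMod 5) : ℂ := ((ε : ℤ) : ℂ) * V j

/-- The (closed, solid) regular pentagons `P = table 1` and `-P = table (-1)`. -/
def table (ε : ℤˣ) : Set ℂ := convexHull ℝ (Set.range (vertex ε))

/-- The closed side with label `j`. In `P`, counterclockwise from the horizontal base, the labels
are `3, 5, 2, 4, 1`; the sides with the same label in `P` and `-P` are parallel. -/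
def side (ε : ℤˣ) (j : ZMod 5) : Set ℂ := segment ℝ (vertex ε (j - 1)) (vertex ε (j + 1))

/-- The disjoint union of the two pentagons. -/
abbrev TwoPentagons : Type := {p : ℤˣ × ℂ // p.2 ∈ table p.1}

/-- The side `j` of each pentagon is glued by a parallel translation to the side `j` of the
other pentagon. -/
def Glue (p q : TwoPentagons) : Prop :=
  ∃ j : ZMod 5, p.1.2 ∈ side p.1.1 j ∧ q.1.1 = -p.1.1 ∧
    q.1.2 = p.1.2 - (vertex p.1.1 (j - 1) + vertex p.1.1 (j + 1))

/-- The double pentagon. -/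
def DoublePentagon : Type := Quot Glue

/-- `q` is the point of the double pentagon represented by the point `x` of the pentagon
`table ε`. -/
def IsAt (q : DoublePentagon) (ε : ℤˣ) (x : ℂ) : Prop :=
  ∃ h : x ∈ table ε, q = Quot.mk Glue ⟨(ε, x), h⟩

/-- `γ` is a (complete) linear trajectory on the double pentagon with constant velocity `v`, which
does not pass through the cone point: immediately after and immediately before every moment `t` it
moves with velocity `v` in one of the two pentagons. -/
def IsLinearTrajectory (v : ℂ) (γ : ℝ → DoublePentagon) : Prop :=
  ∀ t : ℝ,
    (∀ ε j, ¬ IsAt (γ t) ε (vertex ε j)) ∧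
    (∃ ε x, ∀ᶠ r in 𝓝[≥] (0 : ℝ), IsAt (γ (t + r)) ε (x + (r : ℂ) * v)) ∧
    (∃ ε x, ∀ᶠ r in 𝓝[≤] (0 : ℝ), IsAt (γ (t + r)) ε (x + (r : ℂ) * v))

/-- `q` lies on the edge of the double pentagon with label `j`. -/
def OnSide (q : DoublePentagon) (j : ZMod 5) : Prop := ∃ ε, ∃ x ∈ side ε j, IsAt q ε x

/-- The number of times that, in the symbolic orbit of `γ` during the time `[0, L)`, the symbol `a`
occurs and the symbol that follows it is `b`. -/
def pairCount (γ : ℝ → DoublePentagon) (L : ℝ) (a b : ZMod 5) : ℕ :=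
  Set.ncard {t : ℝ | t ∈ Set.Ico 0 L ∧ OnSide (γ t) a ∧
    ∃ t' > t, OnSide (γ t') b ∧ ∀ r ∈ Set.Ioo t t', ∀ j, ¬ OnSide (γ r) j}

/-- The (closed) sectors of directions, for unit vectors `v`, up to sign: sector `m` consists of the
directions that make an angle of at most `π / 10` with the normal of the side `m`. Its boundary
directions are those of two diagonals of the pentagon, and the five sectors cover all directions.
Sector `3` consists of the directions within `π / 10` of the vertical one. -/
def sector (m : ZMod 5) : Set ℂ :=
  {v : ℂ | Real.cos (Real.pi / 10) ≤ |inner ℝ v (V m)|}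

/-- The vector `(c, d, e, f)` of a periodic trajectory of length `L` with direction in sector `m`.
For `m = 3` these are the numbers of the symbols `I = 43`, `II = 41`, `III = 25`, `IV = 23` in its
symbolic orbit; sector `m` is carried to sector `3` by a rotation of the pentagons, under which the
labels change by the constant `3 - m`. -/
def countVector (m : ZMod 5) (γ : ℝ → DoublePentagon) (L : ℝ) : Fin 4 → ℕ :=
  ![pairCount γ L (m + 1) m, pairCount γ L (m + 1) (m - 2),
    pairCount γ L (m - 1) (m + 2), pairCount γ L (m - 1) m]

/-- `β` is a (complete) billiard trajectory of unit speed in the regular pentagon `table ε`, which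
does not pass through a vertex: `u` and `w` are the velocities immediately before and immediately
after the moment `t`. -/
def IsBilliardTrajectory (ε : ℤˣ) (β : ℝ → ℂ) : Prop :=
  ∀ t : ℝ, β t ∈ table ε ∧ (∀ j, β t ≠ vertex ε j) ∧
    ∃ u w : ℂ, ‖u‖ = 1 ∧ ‖w‖ = 1 ∧
      (∀ᶠ r in 𝓝[≤] (0 : ℝ), β (t + r) = β t + (r : ℂ) * u) ∧
      (∀ᶠ r in 𝓝[≥] (0 : ℝ), β (t + r) = β t + (r : ℂ) * w) ∧
      ((∀ j, β t ∉ side ε j) → w = u) ∧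
      (∀ j, β t ∈ side ε j →
        w = (Submodule.span ℝ {vertex ε (j + 1) - vertex ε (j - 1)}).reflection u)

/-- `T` is an even period of `β`: a positive period that contains an even number of reflections. -/
def IsEvenPeriod (ε : ℤˣ) (β : ℝ → ℂ) (T : ℝ) : Prop :=
  0 < T ∧ Function.Periodic β T ∧
    Even (Set.ncard {t : ℝ | t ∈ Set.Ico 0 T ∧ ∃ j, β t ∈ side ε j})

end Pentagon

end

noncomputable section

namespace Pentagon

/-! The reflection in the line through the centre parallel to the sides `j` carries side `j` of one
pentagon to side `j` of the other, and on that side it coincides with the gluing translation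
(`mirror_eq_sub`). The double pentagon can therefore be folded onto the table along a trajectory: by
a rotation `root k` on the table itself, and by conjugation followed by such a rotation on the other
pentagon. If `k` changes by `turn` at every crossing (`fold_cross`), the folded path is continuous
and its velocity is reflected at the sides. It is a billiard trajectory
(`Lift.isBilliardTrajectory`), and the only one with the given initial germ
(`IsBilliardTrajectory.unique`).

Every crossing switches the pentagon, so an even number of reflections means being back in the same
pentagon. Hence `T` is an even period of the billiard exactly when it is a period of the linear
trajectory and the total rotation `rot T` in `ZMod 5` vanishes. Since `rot (n * L) = n * rot L` and
5 is prime, the least even period is `L` or `5 * L` according to whether `rot L` is zero.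

To compute `rot L`, note that crossing side `j` turns by `±(2 * j - 1)`, with the sign alternating
between the pentagons. A visit to a pentagon entered through `a` and left through `b` thus
contributes `±2 * (a - b)`. Take the pentagon `η` in which `v` points towards side `m`. In sector
`m` the only passages through it are the four counted pairs (`no_pass`), with `a - b` equal to 1, 3,
-3, -1. The sum is `±2 * (c + 3 * d - 3 * e - f)`, and 3 is -2 modulo 5 (`Lift.rot_eq`). -/

open ComplexConjugate

/-! ### Roots of unity, vertices and the inradius -/

/-- The fifth root of unity `exp (6πij/5)`. -/
def root (j : ZMod 5) : Circle := ZMod.toCircle (3 * j)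

lemma root_add (a b : ZMod 5) : root (a + b) = root a * root b := by
  simp [root, mul_add, AddChar.map_add_eq_mul]

lemma root_zero : root 0 = 1 := by simp [root]

lemma root_neg (a : ZMod 5) : root (-a) = (root a)⁻¹ := by
  rw [eq_inv_iff_mul_eq_one, ← root_add, neg_add_cancel, root_zero]

lemma coe_root_add (a b : ZMod 5) : (root (a + b) : ℂ) = root a * root b := by
  rw [root_add, Circle.coe_mul]

lemma conj_root (a : ZMod 5) : conj (root a : ℂ) = root (-a) := by
  rw [root_neg, Circle.coe_inv_eq_conj]

lemma root_injective : Function.Injective root := fun a b h => by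
  have h3 : 3 * a = 3 * b := ZMod.injective_toCircle (N := 5) h
  clear h
  revert a b; decide

lemma root_intCast (n : ℤ) :
    (root (n : ZMod 5) : ℂ) = Complex.exp (((6 * Real.pi * n / 5 : ℝ) : ℂ) * Complex.I) := by
  have h : (3 * (n : ZMod 5)) = ((3 * n : ℤ) : ZMod 5) := by push_cast; ring
  rw [root, h, ZMod.toCircle_intCast]
  congr 1
  push_cast
  ring

lemma V_eq (j : ZMod 5) : V j = Complex.I * root (j + 2) := by
  -- Modulo 5, `j + 2` is `j - 3`: the apex, with label 3, corresponds to `root 0`.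
  have h : j + 2 = (((j.val : ℤ) - 3 : ℤ) : ZMod 5) := by revert j; decide
  rw [V, h, root_intCast]
  have : (((Real.pi / 2 + 6 * Real.pi * ((j.val : ℝ) - 3) / 5 : ℝ) : ℂ) * Complex.I) =
    (Real.pi / 2) * Complex.I +
      ((6 * Real.pi * (((j.val : ℤ) - 3 : ℤ) : ℝ) / 5 : ℝ) : ℂ) * Complex.I := by
    push_cast; ring
  rw [this, Complex.exp_add, Complex.exp_pi_div_two_mul_I]

/-- The inradius of the pentagon. -/
def inradius : ℝ := Real.cos (Real.pi / 5)

lemma inradius_pos : 0 < inradius :=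
  Real.cos_pos_of_mem_Ioo ⟨by linarith [Real.pi_pos], by linarith [Real.pi_pos]⟩

lemma inradius_eq : inradius = (1 + √5) / 4 := Real.cos_pi_div_five

/-- The minimal equation of cos(π/5); with the bounds below it replaces trigonometry in the later
estimates. -/
lemma inradius_sq : 4 * inradius ^ 2 = 2 * inradius + 1 := by
  have := Real.sq_sqrt (show (0 : ℝ) ≤ 5 by norm_num)
  rw [inradius_eq]; nlinarith

lemma inradius_bounds : 4 / 5 < inradius ∧ inradius < 1 := by
  have h := inradius_sq
  have := inradius_pos
  constructor <;> nlinarith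

lemma re_root_intCast (n : ℤ) : (root (n : ZMod 5) : ℂ).re = Real.cos (6 * Real.pi * n / 5) := by
  rw [root_intCast, Complex.exp_ofReal_mul_I_re]

lemma re_root_neg (a : ZMod 5) : (root (-a) : ℂ).re = (root a : ℂ).re := by
  rw [← conj_root, Complex.conj_re]

lemma re_root_zero : (root 0 : ℂ).re = 1 := by simp [root_zero]

lemma re_root_one : (root 1 : ℂ).re = -inradius := by
  have := re_root_intCast 1
  rw [Int.cast_one] at this
  rw [this, inradius, ← Real.cos_add_pi]
  congr 1; push_cast; ring

lemma re_root_two : (root 2 : ℂ).re = inradius - 1 / 2 := by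
  have := re_root_intCast 2
  rw [Int.cast_ofNat] at this
  have h2 : Real.cos (6 * Real.pi * (2 : ℤ) / 5) = Real.cos (2 * (Real.pi / 5)) := by
    rw [← Real.cos_add_two_pi (2 * (Real.pi / 5))]; congr 1; push_cast; ring
  rw [this, h2, Real.cos_two_mul]
  have h := inradius_sq
  rw [inradius] at h ⊢
  linarith

lemma re_root_three : (root 3 : ℂ).re = inradius - 1 / 2 := by
  rw [← re_root_two, ← re_root_neg]; rfl

lemma re_root_four : (root 4 : ℂ).re = -inradius := by
  rw [← re_root_one, ← re_root_neg]; rfl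

lemma vertex_neg (ε : ℤˣ) (j : ZMod 5) : vertex (-ε) j = -vertex ε j := by
  simp [vertex]

lemma sign_cases (ε : ℤˣ) : ε = 1 ∨ ε = -1 := Int.units_eq_one_or ε

lemma eq_neg_of_ne {ε ε' : ℤˣ} (h : ε ≠ ε') : ε = -ε' := by
  rcases sign_cases ε with rfl | rfl <;> rcases sign_cases ε' with rfl | rfl <;> simp_all

lemma neg_sign_ne (ε : ℤˣ) : -ε ≠ ε := by
  rcases sign_cases ε with rfl | rfl <;> decide

lemma inner_vertex (ε : ℤˣ) (a b : ZMod 5) :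
    inner ℝ (vertex ε a) (vertex ε b) = (root (a - b) : ℂ).re := by
  have h : conj (V a) * V b = root (b - a) := by
    rw [V_eq, V_eq, map_mul, conj_root, Complex.conj_I,
      show b - a = -(a + 2) + (b + 2) by abel, coe_root_add (-(a + 2)) (b + 2)]
    linear_combination (-(root (-(a + 2)) : ℂ) * root (b + 2)) * Complex.I_mul_I
  have h2 : inner ℝ (vertex ε a) (vertex ε b) = (conj (V a) * V b).re := by
    rw [Complex.inner, mul_comm]
    rcases sign_cases ε with rfl | rfl <;> simp [vertex, mul_comm]
  rw [h2, h, ← re_root_neg, neg_sub]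

lemma norm_V (j : ZMod 5) : ‖V j‖ = 1 := by rw [V_eq, norm_mul, Complex.norm_I, Circle.norm_coe, one_mul]

lemma norm_vertex (ε : ℤˣ) (j : ZMod 5) : ‖vertex ε j‖ = 1 := by
  rcases sign_cases ε with rfl | rfl <;> simp [vertex, norm_V]

lemma inner_vertex_self (ε : ℤˣ) (j : ZMod 5) : inner ℝ (vertex ε j) (vertex ε j) = (1 : ℝ) := by
  rw [inner_vertex, sub_self, re_root_zero]

lemma vertex_mem_table (ε : ℤˣ) (j : ZMod 5) : vertex ε j ∈ table ε :=
  subset_convexHull ℝ _ ⟨j, rfl⟩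

lemma side_subset_table (ε : ℤˣ) (j : ZMod 5) : side ε j ⊆ table ε :=
  (convex_convexHull ℝ _).segment_subset (vertex_mem_table ε _) (vertex_mem_table ε _)

lemma norm_le_of_mem_table {ε : ℤˣ} {x : ℂ} (hx : x ∈ table ε) : ‖x‖ ≤ 1 := by
  have : table ε ⊆ Metric.closedBall 0 1 := by
    refine convexHull_min ?_ (convex_closedBall _ _)
    rintro _ ⟨j, rfl⟩
    simp [norm_vertex]
  simpa using this hx

lemma vertex_add (ε : ℤˣ) (j : ZMod 5) :
    vertex ε (j - 1) + vertex ε (j + 1) = (-2 * inradius : ℝ) • vertex ε j := by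
  have h1 : (root (-1) : ℂ) + root 1 = (-2 * inradius : ℝ) := by
    rw [← conj_root, add_comm, Complex.add_conj, re_root_one]; push_cast; ring
  have h2 : V (j - 1) + V (j + 1) = (-2 * inradius : ℝ) • V j := by
    rw [V_eq, V_eq, V_eq, show j - 1 + 2 = (j + 2) + -1 by ring,
      show j + 1 + 2 = (j + 2) + 1 by ring, coe_root_add (j + 2), coe_root_add (j + 2),
      Complex.real_smul, ← h1]
    ring
  rw [vertex, vertex, vertex, ← mul_add, h2, mul_smul_comm]

/-! ### Sides as faces of the pentagon -/

/-- The coefficients of a point of the pentagon with respect to the vertices. -/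
lemma exists_weights {ε : ℤˣ} {x : ℂ} (hx : x ∈ table ε) :
    ∃ w : ZMod 5 → ℝ, (∀ i, 0 ≤ w i) ∧ ∑ i, w i = 1 ∧ ∑ i, w i • vertex ε i = x := by
  rw [table, convexHull_range_eq_exists_affineCombination] at hx
  obtain ⟨s, w, hw0, hw1, rfl⟩ := hx
  classical
  refine ⟨fun i => if i ∈ s then w i else 0, fun i => ?_, ?_, ?_⟩
  · dsimp only
    split_ifs with h
    exacts [hw0 i h, le_rfl]
  · simpa using hw1
  · rw [s.affineCombination_eq_linear_combination _ _ hw1]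
    simp [ite_smul]

/-- The bracket is the height above side `j`: the endpoints `j - 1`, `j + 1` have height 0, and the
other three vertices have positive height. So the height is nonnegative on the pentagon and vanishes
exactly on the side. -/
lemma inner_sum_vertex (ε : ℤˣ) (w : ZMod 5 → ℝ) (j : ZMod 5) (hw : ∑ i, w i = 1) :
    inner ℝ (∑ i, w i • vertex ε i) (vertex ε j) =
      -inradius + (w j * (1 + inradius) + (w (j + 2) + w (j - 2)) * (2 * inradius - 1 / 2)) := by
  have hs : ∀ g : ZMod 5 → ℝ, ∑ i, g i = g j + g (j + 1) + g (j + 2) + g (j + 3) + g (j + 4) := by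
    intro g
    rw [← Equiv.sum_comp (Equiv.addLeft j)]
    simp only [Equiv.coe_addLeft]
    refine (Fin.sum_univ_five (fun i : ZMod 5 => g (j + i))).trans ?_
    change g (j + 0) + g (j + 1) + g (j + 2) + g (j + 3) + g (j + 4) = _
    rw [add_zero]
  rw [sum_inner]
  simp_rw [real_inner_smul_left, inner_vertex]
  rw [hs]
  rw [hs] at hw
  simp only [sub_self, add_sub_cancel_left, re_root_zero, re_root_one, re_root_two, re_root_three,
    re_root_four, show j - 2 = j + 3 by rw [sub_eq_add_neg]; rfl]
  linear_combination (-inradius) * hw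

lemma le_inner_vertex {ε : ℤˣ} {x : ℂ} (hx : x ∈ table ε) (j : ZMod 5) :
    -inradius ≤ inner ℝ x (vertex ε j) := by
  obtain ⟨w, h0, h1, rfl⟩ := exists_weights hx
  rw [inner_sum_vertex _ _ _ h1]
  have := inradius_bounds
  have := mul_nonneg (h0 j) (by linarith : (0 : ℝ) ≤ 1 + inradius)
  have := mul_nonneg (add_nonneg (h0 (j + 2)) (h0 (j - 2)))
    (by linarith : (0 : ℝ) ≤ 2 * inradius - 1 / 2)
  linarith

lemma mem_side_iff {ε : ℤˣ} {x : ℂ} {j : ZMod 5} :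
    x ∈ side ε j ↔ x ∈ table ε ∧ inner ℝ x (vertex ε j) = -inradius := by
  constructor
  · intro hx
    refine ⟨side_subset_table ε j hx, ?_⟩
    obtain ⟨a, b, ha, hb, hab, rfl⟩ := hx
    rw [inner_add_left, real_inner_smul_left, real_inner_smul_left, inner_vertex, inner_vertex,
      show j - 1 - j = -1 by ring, show j + 1 - j = 1 by ring, re_root_neg, re_root_one]
    linear_combination (-inradius) * hab
  · rintro ⟨hx, he⟩
    obtain ⟨w, h0, h1, rfl⟩ := exists_weights hx
    rw [inner_sum_vertex _ _ _ h1] at he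
    have hb := inradius_bounds
    have e1 := mul_nonneg (h0 j) (by linarith : (0 : ℝ) ≤ 1 + inradius)
    have e2 := mul_nonneg (add_nonneg (h0 (j + 2)) (h0 (j - 2)))
      (by linarith : (0 : ℝ) ≤ 2 * inradius - 1 / 2)
    have w0 : w j = 0 := by
      have : w j * (1 + inradius) = 0 := by linarith
      rcases mul_eq_zero.1 this with h | h <;> linarith
    have w23 : w (j + 2) + w (j - 2) = 0 := by
      have : (w (j + 2) + w (j - 2)) * (2 * inradius - 1 / 2) = 0 := by linarith
      rcases mul_eq_zero.1 this with h | h <;> linarith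
    have w2 : w (j + 2) = 0 := by linarith [h0 (j + 2), h0 (j - 2)]
    have w3 : w (j - 2) = 0 := by linarith [h0 (j + 2), h0 (j - 2)]
    have hz : ∀ i, i ≠ j - 1 → i ≠ j + 1 → w i = 0 := by
      intro i hi hi'
      have : i = j ∨ i = j + 2 ∨ i = j - 2 := by
        clear * - hi hi'; revert i j; decide
      rcases this with rfl | rfl | rfl <;> assumption
    have hne : j - 1 ≠ j + 1 := by clear * -; revert j; decide
    refine ⟨w (j - 1), w (j + 1), h0 _, h0 _, ?_, ?_⟩
    · rw [← h1, Fintype.sum_eq_add _ _ hne fun i hi => hz i hi.1 hi.2]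
    · rw [Fintype.sum_eq_add _ _ hne fun i hi => by rw [hz i hi.1 hi.2, zero_smul]]

lemma eq_vertex_of_mem_side {ε : ℤˣ} {x : ℂ} {i j : ZMod 5} (hi : x ∈ side ε i)
    (hj : x ∈ side ε j) (hij : i ≠ j) : ∃ a, x = vertex ε a := by
  have h2 := (mem_side_iff.1 hi).2
  obtain ⟨a, b, ha, hb, hab, rfl⟩ := hj
  rw [inner_add_left, real_inner_smul_left, real_inner_smul_left, inner_vertex, inner_vertex] at h2
  have hbd := inradius_bounds
  have : i = j + 1 ∨ i = j + 2 ∨ i = j + 3 ∨ i = j + 4 := by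
    clear * - hij; revert i j; decide
  -- Labels of adjacent sides differ by 2 or 3, and such sides share one vertex. The cases of
  -- difference 1 and 4 are disjoint sides.
  rcases this with rfl | rfl | rfl | rfl
  · rw [show j - 1 - (j + 1) = 3 by ring_nf; rfl, show j + 1 - (j + 1) = 0 by ring,
      re_root_three, re_root_zero] at h2
    nlinarith
  · rw [show j - 1 - (j + 2) = 2 by ring_nf; rfl, show j + 1 - (j + 2) = 4 by ring_nf; rfl,
      re_root_two, re_root_four] at h2
    have : a * (2 * inradius - 1 / 2) = 0 := by linear_combination h2 + inradius * hab
    have ha0 : a = 0 := by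
      rcases mul_eq_zero.1 this with h | h <;> linarith
    exact ⟨j + 1, by rw [ha0, show b = 1 by linarith]; simp⟩
  · rw [show j - 1 - (j + 3) = 1 by ring_nf; rfl, show j + 1 - (j + 3) = 3 by ring_nf; rfl,
      re_root_one, re_root_three] at h2
    have : b * (2 * inradius - 1 / 2) = 0 := by linear_combination h2 + inradius * hab
    have hb0 : b = 0 := by
      rcases mul_eq_zero.1 this with h | h <;> linarith
    exact ⟨j - 1, by rw [hb0, show a = 1 by linarith]; simp⟩
  · rw [show j - 1 - (j + 4) = 0 by ring_nf; rfl, show j + 1 - (j + 4) = 2 by ring_nf; rfl,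
      re_root_two, re_root_zero] at h2
    nlinarith

/-! ### Mirrors and the gluing -/

/-- The reflection in the line through the origin parallel to the sides with label `j`. -/
def mirror (j : ZMod 5) (x : ℂ) : ℂ := root (2 * j - 1) * conj x

lemma mirror_mirror (j : ZMod 5) (x : ℂ) : mirror j (mirror j x) = x := by
  rw [mirror, mirror, map_mul, conj_root, Complex.conj_conj, ← mul_assoc, ← coe_root_add,
    add_neg_cancel, root_zero]
  simp

lemma root_two_mul_sub_one (j : ZMod 5) : (root (2 * j - 1) : ℂ) = -(V j * V j) := by
  rw [V_eq, show 2 * j - 1 = (j + 2) + (j + 2) by ring_nf; rfl,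
    coe_root_add (j + 2) (j + 2)]
  linear_combination ((root (j + 2) : ℂ) * root (j + 2)) * Complex.I_mul_I

lemma mirror_eq (ε : ℤˣ) (j : ZMod 5) (x : ℂ) :
    mirror j x = x - (2 * inner ℝ x (vertex ε j)) • vertex ε j := by
  have h1 : mirror j x = x - (2 * inner ℝ x (V j)) • V j := by
    have hV : conj (V j) * V j = 1 := by
      rw [← Complex.normSq_eq_conj_mul_self, Complex.normSq_eq_norm_sq, norm_V]; simp
    have hi : ((2 * inner ℝ x (V j) : ℝ) : ℂ) = conj x * V j + x * conj (V j) := by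
      rw [Complex.inner, ← Complex.add_conj]; simp [mul_comm]
    rw [mirror, root_two_mul_sub_one, Complex.real_smul, hi]
    linear_combination x * hV
  rw [h1]
  rcases sign_cases ε with rfl | rfl
  · simp [vertex]
  · have : vertex (-1) j = -V j := by simp [vertex]
    rw [this, inner_neg_right, mul_neg, neg_smul_neg]

lemma mirror_add (j : ZMod 5) (x y : ℂ) : mirror j (x + y) = mirror j x + mirror j y := by
  simp [mirror, mul_add]

lemma mirror_smul (j : ZMod 5) (r : ℝ) (x : ℂ) : mirror j (r * x) = r * mirror j x := by
  simp [mirror]; ring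

/-- All points of side `j` have the same normal component `-inradius`, so the reflection moves them
all by the same vector, which is the gluing vector. This links gluing with billiard reflection. -/
lemma mirror_eq_sub {ε : ℤˣ} {j : ZMod 5} {x : ℂ} (hx : x ∈ side ε j) :
    mirror j x = x - (vertex ε (j - 1) + vertex ε (j + 1)) := by
  rw [mirror_eq ε, (mem_side_iff.1 hx).2, vertex_add]
  congr 2; ring

lemma mirror_mem_side {ε : ℤˣ} {j : ZMod 5} {x : ℂ} (hx : x ∈ side ε j) :
    mirror j x ∈ side (-ε) j := by
  rw [mirror_eq_sub hx]
  obtain ⟨a, b, ha, hb, hab, rfl⟩ := hx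
  refine ⟨b, a, hb, ha, by linarith, ?_⟩
  have hb' : (b : ℂ) = 1 - a := by rw [← Complex.ofReal_one, ← hab]; push_cast; ring
  simp only [vertex_neg, Complex.real_smul, hb']
  ring

lemma vertex_mem_side {ε : ℤˣ} {j a : ZMod 5} (h : vertex ε a ∈ side ε j) :
    a = j - 1 ∨ a = j + 1 := by
  have h2 := (mem_side_iff.1 h).2
  have hbd := inradius_bounds
  rw [inner_vertex] at h2
  have hc : a = j - 1 ∨ a = j + 1 ∨ a - j = 0 ∨ a - j = 2 ∨ a - j = 3 := by
    clear * -; revert a j; decide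
  rcases hc with h | h | h | h | h
  · exact Or.inl h
  · exact Or.inr h
  · rw [h, re_root_zero] at h2; linarith
  · rw [h, re_root_two] at h2; linarith
  · rw [h, re_root_three] at h2; linarith

lemma mirror_vertex {ε : ℤˣ} {j a : ZMod 5} (h : vertex ε a ∈ side ε j) :
    ∃ b, mirror j (vertex ε a) = vertex (-ε) b := by
  have e := mirror_eq_sub h
  rcases vertex_mem_side h with rfl | rfl
  · exact ⟨j + 1, by rw [e, vertex_neg]; ring⟩
  · exact ⟨j - 1, by rw [e, vertex_neg]; ring⟩

lemma reflection_eq_mirror (ε : ℤˣ) (j : ZMod 5) (y : ℂ) :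
    (Submodule.span ℝ {vertex ε (j + 1) - vertex ε (j - 1)}).reflection y = mirror j y := by
  set d := vertex ε (j + 1) - vertex ε (j - 1) with hd
  set n := vertex ε j with hn
  have hdn : inner ℝ d n = (0 : ℝ) := by
    rw [hd, hn, inner_sub_left, inner_vertex, inner_vertex, show j - 1 - j = -1 by ring,
      show j + 1 - j = 1 by ring, re_root_neg, sub_self]
  have hnK : n ∈ (Submodule.span ℝ {d})ᗮ := by
    rw [Submodule.mem_orthogonal_singleton_iff_inner_right]; exact hdn
  have hyK : y - (inner ℝ y n : ℝ) • n ∈ Submodule.span ℝ {d} := by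
    have hd0 : d ≠ 0 := by
      intro h0
      have : inner ℝ d (vertex ε (j + 1)) = (0 : ℝ) := by rw [h0, inner_zero_left]
      rw [hd, inner_sub_left, inner_vertex, inner_vertex, sub_self,
        show j - 1 - (j + 1) = 3 by ring_nf; rfl, re_root_zero, re_root_three] at this
      linarith [inradius_bounds]
    have hn0 : n ≠ 0 := by
      intro h0
      have := norm_vertex ε j
      rw [← hn, h0, norm_zero] at this
      norm_num at this
    have hz : inner ℝ n (y - (inner ℝ y n : ℝ) • n) = (0 : ℝ) := by
      rw [inner_sub_right, real_inner_smul_right, hn, inner_vertex_self, real_inner_comm]; ring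
    have : Fact (Module.finrank ℝ ℂ = 1 + 1) := ⟨Complex.finrank_real_complex⟩
    have hfr := Submodule.finrank_orthogonal_span_singleton (𝕜 := ℝ) (n := 1) hn0
    have hdm : d ∈ (Submodule.span ℝ {n})ᗮ := by
      rw [Submodule.mem_orthogonal_singleton_iff_inner_left]; exact hdn
    have hle : Submodule.span ℝ {d} = (Submodule.span ℝ {n})ᗮ := by
      apply Submodule.eq_of_le_of_finrank_eq
      · rw [Submodule.span_singleton_le_iff_mem]; exact hdm
      · rw [hfr, finrank_span_singleton hd0]
    rw [hle, Submodule.mem_orthogonal_singleton_iff_inner_right]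
    exact hz
  have hy : y = (y - (inner ℝ y n : ℝ) • n) + (inner ℝ y n : ℝ) • n := by abel
  conv_lhs => rw [hy]
  rw [map_add, Submodule.reflection_mem_subspace_eq_self hyK, map_smul,
    Submodule.reflection_mem_subspace_orthogonalComplement_eq_neg hnK, mirror_eq ε, ← hn, two_mul,
    add_smul, smul_neg]
  abel

/-! ### Functions that are constant except for isolated jumps -/

/-- The function `J` vanishes outside a closed discrete set. -/
def DiscreteSupport {G : Type*} [Zero G] (J : ℝ → G) : Prop :=
  ∀ t : ℝ, (∀ᶠ r in 𝓝[>] (0 : ℝ), J (t + r) = 0) ∧ ∀ᶠ r in 𝓝[>] (0 : ℝ), J (t - r) = 0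

/-- The function `f` is locally constant except for jumps: it is continuous from the right, and `J t`
is its jump at `t`. -/
def HasJumps {G : Type*} [Add G] (f J : ℝ → G) : Prop :=
  ∀ t : ℝ, (∀ᶠ r in 𝓝[>] (0 : ℝ), f (t + r) = f t) ∧
    ∀ᶠ r in 𝓝[>] (0 : ℝ), f t = f (t - r) + J t

lemma eventually_pos_iff {p : ℝ → Prop} :
    (∀ᶠ r in 𝓝[>] (0 : ℝ), p r) ↔ ∃ δ > 0, ∀ r, 0 < r → r < δ → p r := by
  rw [(nhdsGT_basis (0 : ℝ)).eventually_iff]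
  simp only [Set.mem_Ioo, and_imp]

lemma eventually_nhds_of_eventually_pos {p : ℝ → Prop} {t : ℝ} (h0 : p t)
    (hr : ∀ᶠ r in 𝓝[>] (0 : ℝ), p (t + r)) (hl : ∀ᶠ r in 𝓝[>] (0 : ℝ), p (t - r)) :
    ∀ᶠ s in 𝓝 t, p s := by
  obtain ⟨a, ha, h1⟩ := eventually_pos_iff.1 hr
  obtain ⟨b, hb, h2⟩ := eventually_pos_iff.1 hl
  filter_upwards [Ioo_mem_nhds (show t - b < t by linarith) (show t < t + a by linarith)] with s hs
  rcases lt_trichotomy s t with h | h | h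
  · simpa using h2 (t - s) (by linarith) (by linarith [hs.1])
  · exact h ▸ h0
  · simpa using h1 (s - t) (by linarith) (by linarith [hs.2])

lemma DiscreteSupport.finite {G : Type*} [Zero G] {J : ℝ → G} (hJ : DiscreteSupport J) (a b : ℝ) :
    (Set.Icc a b ∩ Function.support J).Finite := by
  have : ∀ s : Set ℝ, IsCompact s → (s ∩ Function.support J).Finite := by
    intro s hs
    refine hs.induction_on (p := fun s => (s ∩ Function.support J).Finite) (by simp)
      (fun s t hst ht => ht.subset (Set.inter_subset_inter_left _ hst))
      (fun s t h1 h2 => by rw [Set.union_inter_distrib_right]; exact h1.union h2) ?_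
    intro t _
    have : ∀ᶠ x in 𝓝 t, x = t ∨ J x = 0 := by
      refine eventually_nhds_of_eventually_pos (Or.inl rfl) ?_ ?_
      · filter_upwards [(hJ t).1] with r hr using Or.inr hr
      · filter_upwards [(hJ t).2] with r hr using Or.inr hr
    refine ⟨{x | x = t ∨ J x = 0}, mem_nhdsWithin_of_mem_nhds this, ?_⟩
    refine (Set.finite_singleton t).subset ?_
    rintro x ⟨h | h, hx⟩
    exacts [h, absurd h hx]
  exact this _ isCompact_Icc

lemma DiscreteSupport.finite_Ioc {G : Type*} [Zero G] {J : ℝ → G} (hJ : DiscreteSupport J)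
    (a b : ℝ) : (Set.Ioc a b ∩ Function.support J).Finite :=
  (hJ.finite a b).subset (Set.inter_subset_inter_left _ Set.Ioc_subset_Icc_self)

/-- The sum of `J` over the interval `(a, b]`. -/
def jumpSum {G : Type*} [AddCommGroup G] (J : ℝ → G) (a b : ℝ) : G := ∑ᶠ s ∈ Set.Ioc a b, J s

section JumpSum

variable {G : Type*} [AddCommGroup G] {J : ℝ → G}

lemma jumpSum_of_le (J : ℝ → G) {a b : ℝ} (h : b ≤ a) : jumpSum J a b = 0 := by
  rw [jumpSum, Set.Ioc_eq_empty (not_lt.2 h), finsum_mem_empty]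

lemma jumpSum_add (hJ : DiscreteSupport J) {a b c : ℝ} (hab : a ≤ b) (hbc : b ≤ c) :
    jumpSum J a b + jumpSum J b c = jumpSum J a c := by
  rw [jumpSum, jumpSum, jumpSum, ← Set.Ioc_union_Ioc_eq_Ioc hab hbc]
  refine (finsum_mem_union' ?_ (hJ.finite_Ioc a b) (hJ.finite_Ioc b c)).symm
  exact Set.disjoint_left.2 fun x h1 h2 => absurd h1.2 (not_le.2 h2.1)

lemma jumpSum_eq_zero {a b : ℝ} (h : ∀ s, a < s → s ≤ b → J s = 0) : jumpSum J a b = 0 :=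
  finsum_mem_eq_zero_of_forall_eq_zero fun s hs => h s hs.1 hs.2

lemma jumpSum_eq_single {a b : ℝ} (hab : a < b) (h : ∀ s, a < s → s < b → J s = 0) :
    jumpSum J a b = J b := by
  rw [jumpSum, ← finsum_mem_singleton (f := J) (a := b)]
  refine finsum_mem_inter_support_eq _ _ _ ?_
  ext s
  simp only [Set.mem_inter_iff, Set.mem_Ioc, Function.mem_support, Set.mem_singleton_iff]
  refine ⟨fun ⟨hs, h0⟩ => ⟨?_, h0⟩, fun ⟨hs, h0⟩ => ⟨⟨hs ▸ hab, hs.le⟩, h0⟩⟩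
  exact hs.2.eq_of_not_lt fun hlt => h0 (h s hs.1 hlt)

/-- The function with jumps `J` that vanishes at `0`. -/
def cumulative (J : ℝ → G) (t : ℝ) : G := jumpSum J 0 t - jumpSum J t 0

lemma cumulative_sub (hJ : DiscreteSupport J) {a b : ℝ} (hab : a ≤ b) :
    cumulative J b - cumulative J a = jumpSum J a b := by
  rw [cumulative, cumulative]
  rcases le_total 0 a with ha | ha
  · rw [jumpSum_of_le J ha, jumpSum_of_le J (ha.trans hab), ← jumpSum_add hJ ha hab]; abel
  rcases le_total 0 b with hb | hb
  · rw [jumpSum_of_le J ha, jumpSum_of_le J hb, ← jumpSum_add hJ ha hb]; abel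
  · rw [jumpSum_of_le J ha, jumpSum_of_le J hb, ← jumpSum_add hJ hab hb]; abel

lemma hasJumps_cumulative (hJ : DiscreteSupport J) : HasJumps (cumulative J) J := by
  intro t
  constructor
  · obtain ⟨δ, hδ, h⟩ := eventually_pos_iff.1 (hJ t).1
    refine eventually_pos_iff.2 ⟨δ, hδ, fun r h0 h1 => ?_⟩
    rw [← sub_eq_zero, cumulative_sub hJ (by linarith)]
    refine jumpSum_eq_zero fun s hs hs' => ?_
    simpa using h (s - t) (by linarith) (by linarith)
  · obtain ⟨δ, hδ, h⟩ := eventually_pos_iff.1 (hJ t).2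
    refine eventually_pos_iff.2 ⟨δ, hδ, fun r h0 h1 => ?_⟩
    rw [← sub_eq_iff_eq_add', cumulative_sub hJ (by linarith)]
    refine jumpSum_eq_single (by linarith) fun s hs hs' => ?_
    simpa using h (t - s) (by linarith) (by linarith)

lemma HasJumps.discreteSupport {f : ℝ → G} (hf : HasJumps f J) : DiscreteSupport J := by
  intro t
  constructor
  · obtain ⟨δ, hδ, h⟩ := eventually_pos_iff.1 (hf t).1
    refine eventually_pos_iff.2 ⟨δ, hδ, fun r h0 h1 => ?_⟩
    obtain ⟨δ', hδ', h'⟩ := eventually_pos_iff.1 (hf (t + r)).2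
    have e := h' (min δ' r / 2) (by positivity) (by linarith [min_le_left δ' r])
    rw [h r h0 h1, show t + r - min δ' r / 2 = t + (r - min δ' r / 2) by ring,
      h (r - min δ' r / 2) (by linarith [min_le_right δ' r])
        (by linarith [show 0 < min δ' r by positivity])] at e
    simpa using e
  · obtain ⟨δ, hδ, h⟩ := eventually_pos_iff.1 (hf t).2
    refine eventually_pos_iff.2 ⟨δ, hδ, fun r h0 h1 => ?_⟩
    obtain ⟨δ', hδ', h'⟩ := eventually_pos_iff.1 (hf (t - r)).2
    have hm : 0 < min δ' (δ - r) := lt_min hδ' (by linarith)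
    have e := h' (min δ' (δ - r) / 2) (by positivity) (by linarith [min_le_left δ' (δ - r)])
    have e1 := h r h0 h1
    have e2 := h (r + min δ' (δ - r) / 2) (by linarith) (by linarith [min_le_right δ' (δ - r)])
    rw [show t - r - min δ' (δ - r) / 2 = t - (r + min δ' (δ - r) / 2) by ring] at e
    rw [e1] at e2
    have e3 := add_right_cancel e2
    rw [e3] at e
    simpa using e

/-- Subtracting the cumulative sum leaves a locally constant function on the connected real line.
This avoids enumerating the crossings in order. -/
lemma HasJumps.sub_eq {f : ℝ → G} (hf : HasJumps f J) {a b : ℝ} (hab : a ≤ b) :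
    f b - f a = jumpSum J a b := by
  have hJ := hf.discreteSupport
  have hc := hasJumps_cumulative hJ
  have : IsLocallyConstant fun t => f t - cumulative J t := by
    rw [IsLocallyConstant.iff_eventually_eq]
    intro t
    refine eventually_nhds_of_eventually_pos rfl ?_ ?_
    · filter_upwards [(hf t).1, (hc t).1] with r h1 h2
      rw [h1, h2]
    · filter_upwards [(hf t).2, (hc t).2] with r h1 h2
      rw [h1, h2]; abel
  have e := this.apply_eq_of_preconnectedSpace a b
  rw [← cumulative_sub hJ hab]
  rw [sub_eq_sub_iff_add_eq_add] at e ⊢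
  rw [← e, add_comm]

end JumpSum

/-! ### Points of the double pentagon and germs of trajectories -/

lemma Glue.symm {p q : TwoPentagons} (h : Glue p q) : Glue q p := by
  obtain ⟨j, hj, he, hx⟩ := h
  have hm := mirror_mem_side hj
  rw [mirror_eq_sub hj, ← hx, ← he] at hm
  refine ⟨j, hm, by rw [he, neg_neg], ?_⟩
  rw [hx, he, vertex_neg, vertex_neg]
  ring

lemma Glue.eq_mirror {p q : TwoPentagons} (h : Glue p q) :
    ∃ j, p.1.2 ∈ side p.1.1 j ∧ q.1.1 = -p.1.1 ∧ q.1.2 = mirror j p.1.2 := by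
  obtain ⟨j, hj, he, hx⟩ := h
  exact ⟨j, hj, he, by rw [hx, mirror_eq_sub hj]⟩

lemma IsAt.mem_table {q : DoublePentagon} {ε : ℤˣ} {x : ℂ} (h : IsAt q ε x) : x ∈ table ε := h.1

lemma IsAt.mirror {q : DoublePentagon} {ε : ℤˣ} {x : ℂ} {j : ZMod 5} (h : IsAt q ε x)
    (hx : x ∈ side ε j) : IsAt q (-ε) (mirror j x) := by
  obtain ⟨ht, rfl⟩ := h
  refine ⟨side_subset_table _ _ (mirror_mem_side hx), Quot.sound ⟨j, hx, rfl, mirror_eq_sub hx⟩⟩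

lemma IsAt.eq_of_isAt {q q' : DoublePentagon} {ε : ℤˣ} {x : ℂ} (h : IsAt q ε x)
    (h' : IsAt q' ε x) : q = q' := by
  obtain ⟨ht, rfl⟩ := h
  obtain ⟨ht', rfl⟩ := h'
  rfl

/-- Two representatives of a point of the double pentagon are equal or glued. -/
lemma IsAt.unique {q : DoublePentagon} {ε ε' : ℤˣ} {x x' : ℂ} (h : IsAt q ε x)
    (h' : IsAt q ε' x') (hv : ∀ j, x ≠ vertex ε j) :
    (ε' = ε ∧ x' = x) ∨ ∃ j, x ∈ side ε j ∧ ε' = -ε ∧ x' = Pentagon.mirror j x := by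
  -- The claimed gluing class of `x`. It is invariant under gluing and so descends to the quotient.
  let A : TwoPentagons → Prop := fun p =>
    (p.1.1 = ε ∧ p.1.2 = x) ∨ ∃ j, x ∈ side ε j ∧ p.1.1 = -ε ∧ p.1.2 = Pentagon.mirror j x
  have key : ∀ p p', Glue p p' → A p → A p' := by
    intro p p' hg hp
    obtain ⟨i, hi, he, hx⟩ := hg.eq_mirror
    rcases hp with ⟨h1, h2⟩ | ⟨j, hj, h1, h2⟩
    · rw [h1, h2] at hi
      exact Or.inr ⟨i, hi, by rw [he, h1], by rw [hx, h2]⟩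
    · rw [h1, h2] at hi
      -- Gluing the mirrored point along another side would make it a vertex, and then `x` would be
      -- a vertex as well.
      have hij : i = j := by
        by_contra hne
        obtain ⟨a, ha⟩ := eq_vertex_of_mem_side hi (mirror_mem_side hj) hne
        have hs := mirror_mem_side hj
        rw [ha] at hs
        obtain ⟨b, hb⟩ := mirror_vertex hs
        rw [← ha, mirror_mirror, neg_neg] at hb
        exact hv b hb
      subst hij
      exact Or.inl ⟨by rw [he, h1, neg_neg], by rw [hx, h2, mirror_mirror]⟩
  let B : DoublePentagon → Prop :=
    Quot.lift A fun p p' hg => propext ⟨key p p' hg, key p' p hg.symm⟩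
  obtain ⟨ht, rfl⟩ := h
  obtain ⟨ht', hq⟩ := h'
  have hB : B (Quot.mk Glue ⟨(ε, x), ht⟩) := Or.inl ⟨rfl, rfl⟩
  rw [hq] at hB
  exact hB

lemma IsAt.unique_of_not_side {q : DoublePentagon} {ε ε' : ℤˣ} {x x' : ℂ} (h : IsAt q ε x)
    (h' : IsAt q ε' x') (hv : ∀ j, x ∉ side ε j) : ε' = ε ∧ x' = x := by
  have hv' : ∀ j, x ≠ vertex ε j := by
    rintro j rfl
    refine hv (j + 1) ?_
    rw [side, add_sub_cancel_right]
    exact left_mem_segment ℝ _ _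
  rcases h.unique h' hv' with h | ⟨j, hj, _⟩
  · exact h
  · exact absurd hj (hv j)

/-- After the moment `t`, the trajectory `γ` moves from the point `x` of the pentagon `table ε` with
velocity `v`. -/
def RightGerm (v : ℂ) (γ : ℝ → DoublePentagon) (t : ℝ) (ε : ℤˣ) (x : ℂ) : Prop :=
  ∀ᶠ r in 𝓝[≥] (0 : ℝ), IsAt (γ (t + r)) ε (x + (r : ℂ) * v)

/-- Before the moment `t`, the trajectory `γ` moves to the point `x` of the pentagon `table ε` with
velocity `v`. -/
def LeftGerm (v : ℂ) (γ : ℝ → DoublePentagon) (t : ℝ) (ε : ℤˣ) (x : ℂ) : Prop :=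
  ∀ᶠ r in 𝓝[≤] (0 : ℝ), IsAt (γ (t + r)) ε (x + (r : ℂ) * v)

lemma eventually_nonneg_iff {p : ℝ → Prop} :
    (∀ᶠ r in 𝓝[≥] (0 : ℝ), p r) ↔ ∃ δ > 0, ∀ r, 0 ≤ r → r < δ → p r := by
  rw [(nhdsGE_basis (0 : ℝ)).eventually_iff]
  simp only [Set.mem_Ico, and_imp]

lemma eventually_nonpos_iff {p : ℝ → Prop} :
    (∀ᶠ r in 𝓝[≤] (0 : ℝ), p r) ↔ ∃ δ > 0, ∀ r, 0 ≤ r → r < δ → p (-r) := by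
  rw [(nhdsLE_basis (0 : ℝ)).eventually_iff]
  simp only [Set.mem_Ioc, and_imp]
  constructor
  · rintro ⟨a, ha, h⟩
    exact ⟨-a, by linarith, fun r h0 h1 => h (by linarith) (by linarith)⟩
  · rintro ⟨δ, hδ, h⟩
    exact ⟨-δ, by linarith, fun r h0 h1 => by simpa using h (-r) (by linarith) (by linarith)⟩

section

variable {v : ℂ} {γ : ℝ → DoublePentagon} {t : ℝ} {ε ε' : ℤˣ} {x x' : ℂ} {j : ZMod 5}

lemma RightGerm.exists_pos (h : RightGerm v γ t ε x) :
    ∃ δ > 0, ∀ r : ℝ, 0 ≤ r → r < δ → IsAt (γ (t + r)) ε (x + (r : ℂ) * v) :=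
  eventually_nonneg_iff.1 h

lemma LeftGerm.exists_pos (h : LeftGerm v γ t ε x) :
    ∃ δ > 0, ∀ r : ℝ, 0 ≤ r → r < δ → IsAt (γ (t - r)) ε (x - (r : ℂ) * v) := by
  obtain ⟨δ, hδ, h⟩ := eventually_nonpos_iff.1 h
  refine ⟨δ, hδ, fun r h0 h1 => ?_⟩
  have := h r h0 h1
  rwa [← sub_eq_add_neg, Complex.ofReal_neg, neg_mul, ← sub_eq_add_neg] at this

lemma RightGerm.isAt (h : RightGerm v γ t ε x) : IsAt (γ t) ε x := by
  obtain ⟨δ, hδ, h⟩ := h.exists_pos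
  simpa using h 0 le_rfl hδ

lemma LeftGerm.isAt (h : LeftGerm v γ t ε x) : IsAt (γ t) ε x := by
  obtain ⟨δ, hδ, h⟩ := h.exists_pos
  simpa using h 0 le_rfl hδ

lemma IsLinearTrajectory.ne_vertex (hγ : IsLinearTrajectory v γ) (h : IsAt (γ t) ε x) :
    ∀ j, x ≠ vertex ε j := by
  rintro j rfl
  exact (hγ t).1 ε j h

lemma inner_add_mul (x v w : ℂ) (r : ℝ) :
    inner ℝ (x + (r : ℂ) * v) w = inner ℝ x w + r * inner ℝ v w := by
  rw [← Complex.real_smul, inner_add_left, real_inner_smul_left]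

/-- The side on which a representative lies is determined by the point. -/
lemma IsLinearTrajectory.isAt_of_side (hγ : IsLinearTrajectory v γ) (h : IsAt (γ t) ε x)
    (hx : x ∈ side ε j) (h' : IsAt (γ t) ε' x') :
    (ε' = ε ∧ x' = x) ∨ (ε' = -ε ∧ x' = mirror j x) := by
  rcases h.unique h' (hγ.ne_vertex h) with h1 | ⟨i, hi, h1⟩
  · exact Or.inl h1
  · have : i = j := by
      by_contra hne
      obtain ⟨a, ha⟩ := eq_vertex_of_mem_side hi hx hne
      exact hγ.ne_vertex h a ha
    exact Or.inr (this ▸ h1)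

lemma mirror_of_inner_eq_zero (ε : ℤˣ) (h : inner ℝ v (vertex ε j) = (0 : ℝ)) :
    mirror j v = v := by
  rw [mirror_eq ε, h]; simp

lemma mem_side_add_of_slide (hv : inner ℝ v (vertex ε j) = (0 : ℝ)) (r : ℝ)
    (ht : x + (r : ℂ) * v ∈ table ε) :
    x + (r : ℂ) * v ∈ side ε j ↔ inner ℝ x (vertex ε j) = -inradius := by
  rw [mem_side_iff, inner_add_mul, hv, mul_zero, add_zero]
  exact ⟨fun h => h.2, fun h => ⟨ht, h⟩⟩

lemma inner_vertex_sign (hv : inner ℝ v (vertex ε j) = (0 : ℝ)) (ε' : ℤˣ) :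
    inner ℝ v (vertex ε' j) = (0 : ℝ) := by
  by_cases h : ε' = ε
  · rw [h, hv]
  · rw [eq_neg_of_ne h, vertex_neg, inner_neg_right, hv, neg_zero]

/-- A velocity parallel to the side is fixed by its mirror, so motion along the side can be
transferred between the two representatives. -/
lemma IsLinearTrajectory.slide_step (hγ : IsLinearTrajectory v γ) {s : ℝ}
    (hv : inner ℝ v (vertex ε j) = (0 : ℝ)) {ε₁ : ℤˣ} {x₁ : ℂ}
    (h1 : IsAt (γ t) ε₁ x₁) (h2 : IsAt (γ s) ε₁ (x₁ + ((s - t : ℝ) : ℂ) * v))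
    (h : IsAt (γ t) ε x) (hx : x ∈ side ε j) :
    IsAt (γ s) ε (x + ((s - t : ℝ) : ℂ) * v) ∧ x + ((s - t : ℝ) : ℂ) * v ∈ side ε j := by
  rcases hγ.isAt_of_side h hx h1 with ⟨rfl, rfl⟩ | ⟨rfl, rfl⟩
  · exact ⟨h2, (mem_side_add_of_slide hv _ h2.mem_table).2 (mem_side_iff.1 hx).2⟩
  · have hv' := inner_vertex_sign hv (-ε)
    have hs := (mem_side_add_of_slide hv' _ h2.mem_table).2
      (mem_side_iff.1 (mirror_mem_side hx)).2
    have e : mirror j (mirror j x + ((s - t : ℝ) : ℂ) * v) = x + ((s - t : ℝ) : ℂ) * v := by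
      rw [mirror_add, mirror_mirror, mirror_smul, mirror_of_inner_eq_zero ε hv]
    have h3 := h2.mirror hs
    have h4 := mirror_mem_side hs
    rw [e, neg_neg] at h3 h4
    exact ⟨h3, h4⟩

lemma eventually_nhds_of_nonneg_of_nonpos {p : ℝ → Prop} (h1 : ∀ᶠ r in 𝓝[≥] (0 : ℝ), p (t + r))
    (h2 : ∀ᶠ r in 𝓝[≤] (0 : ℝ), p (t + r)) : ∀ᶠ s in 𝓝 t, p s := by
  obtain ⟨a, ha, h1⟩ := eventually_nonneg_iff.1 h1
  obtain ⟨b, hb, h2⟩ := eventually_nonpos_iff.1 h2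
  filter_upwards [Ioo_mem_nhds (show t - b < t by linarith) (show t < t + a by linarith)] with s hs
  rcases le_total s t with h | h
  · simpa using h2 (t - s) (by linarith) (by linarith [hs.1])
  · simpa using h1 (s - t) (by linarith) (by linarith [hs.2])

/-- A trajectory never moves along a side, since it would run into the cone point. -/
lemma IsLinearTrajectory.inner_ne_zero (hγ : IsLinearTrajectory v γ) (hv : ‖v‖ = 1)
    (h : IsAt (γ t) ε x) (hx : x ∈ side ε j) : inner ℝ v (vertex ε j) ≠ (0 : ℝ) := by
  intro h0
  let P : ℝ → Prop := fun s =>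
    IsAt (γ s) ε (x + ((s - t : ℝ) : ℂ) * v) ∧ x + ((s - t : ℝ) : ℂ) * v ∈ side ε j
  -- `R` says that a single straight piece joins the two moments. It is symmetric, holds between
  -- nearby moments and preserves `P`, so `P` is clopen.
  let R : ℝ → ℝ → Prop := fun s s' =>
    ∃ ε₁ x₁, IsAt (γ s) ε₁ x₁ ∧ IsAt (γ s') ε₁ (x₁ + ((s' - s : ℝ) : ℂ) * v)
  have hsymm : ∀ s s', R s s' → R s' s := by
    rintro s s' ⟨ε₁, x₁, h1, h2⟩
    refine ⟨ε₁, _, h2, ?_⟩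
    convert h1 using 1
    push_cast
    ring
  have hstep : ∀ s s', R s s' → P s → P s' := by
    rintro s s' ⟨ε₁, x₁, h1, h2⟩ ⟨h3, h4⟩
    have := hγ.slide_step h0 h1 h2 h3 h4
    have e : x + ((s - t : ℝ) : ℂ) * v + ((s' - s : ℝ) : ℂ) * v =
      x + ((s' - t : ℝ) : ℂ) * v := by push_cast; ring
    rwa [e] at this
  have hR : ∀ s, ∀ᶠ s' in 𝓝 s, R s s' := by
    intro s
    refine eventually_nhds_of_nonneg_of_nonpos ?_ ?_
    · obtain ⟨ε₁, x₁, hr⟩ := (hγ s).2.1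
      filter_upwards [hr] with r h1
      exact ⟨ε₁, x₁, RightGerm.isAt hr, by rwa [add_sub_cancel_left]⟩
    · obtain ⟨ε₁, x₁, hl⟩ := (hγ s).2.2
      filter_upwards [hl] with r h1
      exact ⟨ε₁, x₁, LeftGerm.isAt hl, by rwa [add_sub_cancel_left]⟩
  have hclopen : IsClopen {s | P s} := by
    constructor
    · rw [← isOpen_compl_iff, isOpen_iff_eventually]
      intro s hs
      filter_upwards [hR s] with s' h1 h2
      exact hs (hstep _ _ (hsymm _ _ h1) h2)
    · rw [isOpen_iff_eventually]
      intro s hs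
      filter_upwards [hR s] with s' h1
      exact hstep _ _ h1 hs
  have hP : ∀ s, P s := by
    have : {s | P s} = Set.univ := hclopen.eq_univ ⟨t, by simpa [P] using ⟨h, hx⟩⟩
    exact Set.eq_univ_iff_forall.1 this
  -- The pentagon lies in the unit disc, so a displacement of length 3 is impossible.
  have h1 := norm_le_of_mem_table (hP (t + 3)).1.mem_table
  have h2 := norm_le_of_mem_table h.mem_table
  have h3 : ‖((t + 3 - t : ℝ) : ℂ) * v‖ = 3 := by
    rw [norm_mul, hv, add_sub_cancel_left]; norm_num
  have h4 := norm_sub_le (x + ((t + 3 - t : ℝ) : ℂ) * v) x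
  rw [add_sub_cancel_left] at h4
  linarith

lemma eventually_pos_affine_ne (a b c : ℝ) (hb : b ≠ 0) :
    ∀ᶠ r in 𝓝[>] (0 : ℝ), a + r * b ≠ c := by
  rw [eventually_pos_iff]
  by_cases h : 0 < (c - a) / b
  · refine ⟨(c - a) / b, h, fun r h0 h1 he => ?_⟩
    have : r = (c - a) / b := by
      rw [eq_div_iff hb]
      linarith
    linarith
  · refine ⟨1, one_pos, fun r h0 h1 he => h ?_⟩
    rw [← he, add_sub_cancel_left, mul_div_cancel_right₀ _ hb]
    exact h0

lemma RightGerm.pos (h : RightGerm v γ t ε x) {p : ℝ → Prop}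
    (hp : ∀ r, IsAt (γ (t + r)) ε (x + (r : ℂ) * v) → p r) : ∀ᶠ r in 𝓝[>] (0 : ℝ), p r := by
  obtain ⟨δ, hδ, h⟩ := h.exists_pos
  exact eventually_pos_iff.2 ⟨δ, hδ, fun r h0 h1 => hp r (h r h0.le h1)⟩

lemma LeftGerm.pos (h : LeftGerm v γ t ε x) {p : ℝ → Prop}
    (hp : ∀ r, IsAt (γ (t - r)) ε (x - (r : ℂ) * v) → p r) : ∀ᶠ r in 𝓝[>] (0 : ℝ), p r := by
  obtain ⟨δ, hδ, h⟩ := h.exists_pos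
  exact eventually_pos_iff.2 ⟨δ, hδ, fun r h0 h1 => hp r (h r h0.le h1)⟩

lemma RightGerm.eventually_not_side (hγ : IsLinearTrajectory v γ) (hv : ‖v‖ = 1)
    (h : RightGerm v γ t ε x) : ∀ᶠ r : ℝ in 𝓝[>] (0 : ℝ), ∀ j, x + (r : ℂ) * v ∉ side ε j := by
  rw [eventually_all]
  intro j
  by_cases hb : inner ℝ v (vertex ε j) = (0 : ℝ)
  · exact h.pos fun r hr hs => hγ.inner_ne_zero hv hr hs hb
  · filter_upwards [eventually_pos_affine_ne (inner ℝ x (vertex ε j)) _ (-inradius) hb] with r hr hs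
    rw [mem_side_iff, inner_add_mul] at hs
    exact hr hs.2

lemma LeftGerm.eventually_not_side (hγ : IsLinearTrajectory v γ) (hv : ‖v‖ = 1)
    (h : LeftGerm v γ t ε x) : ∀ᶠ r : ℝ in 𝓝[>] (0 : ℝ), ∀ j, x - (r : ℂ) * v ∉ side ε j := by
  rw [eventually_all]
  intro j
  by_cases hb : inner ℝ v (vertex ε j) = (0 : ℝ)
  · exact h.pos fun r hr hs => hγ.inner_ne_zero hv hr hs hb
  · filter_upwards [eventually_pos_affine_ne (inner ℝ x (vertex ε j)) _ (-inradius)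
      (neg_ne_zero.2 hb)] with r hr hs
    rw [mem_side_iff, ← sub_eq_zero, sub_eq_add_neg x, ← neg_mul, ← Complex.ofReal_neg,
      inner_add_mul] at hs
    exact hr (by linarith [hs.2])

lemma RightGerm.inner_pos (hγ : IsLinearTrajectory v γ) (hv : ‖v‖ = 1)
    (h : RightGerm v γ t ε x) (hx : x ∈ side ε j) : (0 : ℝ) < inner ℝ v (vertex ε j) := by
  refine lt_of_le_of_ne ?_ (hγ.inner_ne_zero hv h.isAt hx).symm
  obtain ⟨δ, hδ, h⟩ := h.exists_pos
  have h1 := le_inner_vertex (h (δ / 2) (by linarith) (by linarith)).mem_table j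
  rw [inner_add_mul, (mem_side_iff.1 hx).2] at h1
  exact nonneg_of_mul_nonneg_right (by linarith) (half_pos hδ)

lemma LeftGerm.inner_neg (hγ : IsLinearTrajectory v γ) (hv : ‖v‖ = 1)
    (h : LeftGerm v γ t ε x) (hx : x ∈ side ε j) : inner ℝ v (vertex ε j) < (0 : ℝ) := by
  refine lt_of_le_of_ne ?_ (hγ.inner_ne_zero hv h.isAt hx)
  obtain ⟨δ, hδ, h⟩ := h.exists_pos
  have h1 := le_inner_vertex (h (δ / 2) (by linarith) (by linarith)).mem_table j
  rw [sub_eq_add_neg, ← neg_mul, ← Complex.ofReal_neg, inner_add_mul, (mem_side_iff.1 hx).2] at h1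
  nlinarith

/-- Shortly after `t` the trajectory is off the sides, where its representative is unique. -/
lemma RightGerm.unique (hγ : IsLinearTrajectory v γ) (hv : ‖v‖ = 1)
    (h : RightGerm v γ t ε x) (h' : RightGerm v γ t ε' x') : ε' = ε ∧ x' = x := by
  have h1 := h.pos (p := fun r => IsAt (γ (t + r)) ε (x + (r : ℂ) * v)) fun r hr => hr
  have h2 := h'.pos (p := fun r => IsAt (γ (t + r)) ε' (x' + (r : ℂ) * v)) fun r hr => hr
  obtain ⟨r, h3, h4, h5⟩ := (h1.and (h2.and (h.eventually_not_side hγ hv))).exists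
  obtain ⟨h6, h7⟩ := h3.unique_of_not_side h4 h5
  exact ⟨h6, add_right_cancel h7⟩

lemma RightGerm.shift (h : RightGerm v γ t ε x) :
    ∀ᶠ r : ℝ in 𝓝[>] (0 : ℝ), RightGerm v γ (t + r) ε (x + (r : ℂ) * v) := by
  obtain ⟨δ, hδ, h⟩ := h.exists_pos
  refine eventually_pos_iff.2 ⟨δ, hδ, fun r h0 h1 => eventually_nonneg_iff.2
    ⟨δ - r, by linarith, fun s h2 h3 => ?_⟩⟩
  have := h (r + s) (by linarith) (by linarith)
  convert this using 1
  · rw [add_assoc]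
  · push_cast; ring

lemma LeftGerm.shift (h : LeftGerm v γ t ε x) :
    ∀ᶠ r : ℝ in 𝓝[>] (0 : ℝ), RightGerm v γ (t - r) ε (x - (r : ℂ) * v) := by
  obtain ⟨δ, hδ, h⟩ := h.exists_pos
  refine eventually_pos_iff.2 ⟨δ, hδ, fun r h0 h1 => eventually_nonneg_iff.2
    ⟨r, by linarith, fun s h2 h3 => ?_⟩⟩
  have := h (r - s) (by linarith) (by linarith)
  convert this using 1
  · congr 1; ring
  · push_cast; ring

/-- The germs before and after a moment agree, or are related by a crossing of a side. -/
lemma LeftGerm.eq_or_cross (hγ : IsLinearTrajectory v γ) (hv : ‖v‖ = 1)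
    (h : LeftGerm v γ t ε x) (h' : RightGerm v γ t ε' x') :
    (ε' = ε ∧ x' = x ∧ ∀ j, x ∉ side ε j) ∨
      ∃ j, x ∈ side ε j ∧ ε' = -ε ∧ x' = mirror j x := by
  by_cases hx : ∃ j, x ∈ side ε j
  · obtain ⟨j, hj⟩ := hx
    rcases hγ.isAt_of_side h.isAt hj h'.isAt with ⟨rfl, rfl⟩ | h1
    -- With the same representative before and after, `v` would point both out of and into the
    -- pentagon at side `j`.
    · exact absurd (h.inner_neg hγ hv hj) (h'.inner_pos hγ hv hj).not_gt
    · exact Or.inr ⟨j, hj, h1⟩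
  · push Not at hx
    obtain ⟨h1, h2⟩ := h.isAt.unique_of_not_side h'.isAt hx
    exact Or.inl ⟨h1, h2, hx⟩

lemma IsLinearTrajectory.onSide_iff (hγ : IsLinearTrajectory v γ) (h : IsAt (γ t) ε x) :
    OnSide (γ t) j ↔ x ∈ side ε j := by
  refine ⟨fun ⟨ε', x', hx, h'⟩ => ?_, fun hx => ⟨ε, x, hx, h⟩⟩
  rcases hγ.isAt_of_side h' hx h with ⟨rfl, rfl⟩ | ⟨rfl, rfl⟩
  · exact hx
  · exact mirror_mem_side hx

lemma IsLinearTrajectory.onSide_unique (hγ : IsLinearTrajectory v γ) {i : ZMod 5}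
    (hi : OnSide (γ t) i) (hj : OnSide (γ t) j) : i = j := by
  obtain ⟨ε, x, hx, h⟩ := hi
  by_contra hne
  obtain ⟨a, ha⟩ := eq_vertex_of_mem_side hx ((hγ.onSide_iff h).1 hj) hne
  exact hγ.ne_vertex h a ha

end

/-! ### Crossings and flights between them -/

/-- The moments at which `γ` is on a side. -/
def crossings (γ : ℝ → DoublePentagon) : Set ℝ := {t | ∃ j, OnSide (γ t) j}

open Classical in
/-- The label of the side on which `γ` is at a crossing. -/
def sideLabel (γ : ℝ → DoublePentagon) (t : ℝ) : ZMod 5 :=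
  if h : ∃ j, OnSide (γ t) j then h.choose else 0

lemma onSide_sideLabel {γ : ℝ → DoublePentagon} {t : ℝ} (h : t ∈ crossings γ) :
    OnSide (γ t) (sideLabel γ t) := by
  have h' : ∃ j, OnSide (γ t) j := h
  rw [sideLabel, dif_pos h']
  exact h'.choose_spec

/-- A linear trajectory with unit velocity, together with a choice of the straight motions in the
two pentagons that represent it before and after every moment. -/
structure Lift (v : ℂ) (γ : ℝ → DoublePentagon) where
  traj : IsLinearTrajectory v γ
  unit : ‖v‖ = 1
  /-- the pentagon after the moment -/
  εr : ℝ → ℤˣ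
  /-- the position in the pentagon `εr` -/
  xr : ℝ → ℂ
  /-- the pentagon before the moment -/
  εl : ℝ → ℤˣ
  /-- the position in the pentagon `εl` -/
  xl : ℝ → ℂ
  right : ∀ t, RightGerm v γ t (εr t) (xr t)
  left : ∀ t, LeftGerm v γ t (εl t) (xl t)

lemma IsLinearTrajectory.exists_lift {v : ℂ} {γ : ℝ → DoublePentagon}
    (hγ : IsLinearTrajectory v γ) (hv : ‖v‖ = 1) : Nonempty (Lift v γ) := by
  have h := hγ
  choose _ hr hl using h
  choose εr xr hr using hr
  choose εl xl hl using hl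
  exact ⟨⟨hγ, hv, εr, xr, εl, xl, hr, hl⟩⟩

namespace Lift

variable {v : ℂ} {γ : ℝ → DoublePentagon} (A : Lift v γ)
include A

lemma right_unique {t : ℝ} {ε : ℤˣ} {x : ℂ} (h : RightGerm v γ t ε x) :
    A.εr t = ε ∧ A.xr t = x := h.unique A.traj A.unit (A.right t)

lemma isAt_right (t : ℝ) : IsAt (γ t) (A.εr t) (A.xr t) := (A.right t).isAt

lemma isAt_left (t : ℝ) : IsAt (γ t) (A.εl t) (A.xl t) := (A.left t).isAt

lemma right_step (t : ℝ) :
    ∀ᶠ r : ℝ in 𝓝[>] (0 : ℝ), A.εr (t + r) = A.εr t ∧ A.xr (t + r) = A.xr t + (r : ℂ) * v := by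
  filter_upwards [(A.right t).shift] with r hr using A.right_unique hr

lemma left_step (t : ℝ) :
    ∀ᶠ r : ℝ in 𝓝[>] (0 : ℝ), A.εr (t - r) = A.εl t ∧ A.xr (t - r) = A.xl t - (r : ℂ) * v := by
  filter_upwards [(A.left t).shift] with r hr using A.right_unique hr

lemma mem_crossings_iff {t : ℝ} {ε : ℤˣ} {x : ℂ} (h : IsAt (γ t) ε x) :
    t ∈ crossings γ ↔ ∃ j, x ∈ side ε j :=
  exists_congr fun _ => A.traj.onSide_iff h

lemma right_not_mem_crossings (t : ℝ) : ∀ᶠ r in 𝓝[>] (0 : ℝ), t + r ∉ crossings γ := by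
  filter_upwards [(A.right t).shift, (A.right t).eventually_not_side A.traj A.unit] with r h1 h2
  rw [A.mem_crossings_iff h1.isAt]
  exact not_exists.2 h2

lemma left_not_mem_crossings (t : ℝ) : ∀ᶠ r in 𝓝[>] (0 : ℝ), t - r ∉ crossings γ := by
  filter_upwards [(A.left t).shift, (A.left t).eventually_not_side A.traj A.unit] with r h1 h2
  rw [A.mem_crossings_iff h1.isAt]
  exact not_exists.2 h2

lemma eq_of_not_mem_crossings {t : ℝ} (h : t ∉ crossings γ) :
    A.εr t = A.εl t ∧ A.xr t = A.xl t := by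
  rw [A.mem_crossings_iff (A.isAt_left t)] at h
  rcases (A.left t).eq_or_cross A.traj A.unit (A.right t) with h1 | ⟨j, hj, _⟩
  · exact ⟨h1.1, h1.2.1⟩
  · exact absurd ⟨j, hj⟩ h

lemma left_mem_side {t : ℝ} (h : t ∈ crossings γ) : A.xl t ∈ side (A.εl t) (sideLabel γ t) :=
  (A.traj.onSide_iff (A.isAt_left t)).1 (onSide_sideLabel h)

lemma right_mem_side {t : ℝ} (h : t ∈ crossings γ) : A.xr t ∈ side (A.εr t) (sideLabel γ t) :=
  (A.traj.onSide_iff (A.isAt_right t)).1 (onSide_sideLabel h)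

lemma sideLabel_eq {t : ℝ} {j : ZMod 5} (h : OnSide (γ t) j) : sideLabel γ t = j :=
  A.traj.onSide_unique (onSide_sideLabel ⟨j, h⟩) h

lemma cross {t : ℝ} (h : t ∈ crossings γ) :
    A.εr t = -A.εl t ∧ A.xr t = mirror (sideLabel γ t) (A.xl t) := by
  rcases (A.left t).eq_or_cross A.traj A.unit (A.right t) with h1 | ⟨j, hj, h1, h2⟩
  · exact absurd (A.left_mem_side h) (h1.2.2 _)
  · rw [A.sideLabel_eq ⟨_, _, hj, A.isAt_left t⟩]
    exact ⟨h1, h2⟩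

lemma inner_pos {t : ℝ} (h : t ∈ crossings γ) :
    (0 : ℝ) < inner ℝ v (vertex (A.εr t) (sideLabel γ t)) :=
  (A.right t).inner_pos A.traj A.unit (A.right_mem_side h)

lemma inner_neg {t : ℝ} (h : t ∈ crossings γ) :
    inner ℝ v (vertex (A.εl t) (sideLabel γ t)) < (0 : ℝ) :=
  (A.left t).inner_neg A.traj A.unit (A.left_mem_side h)

open Classical in
lemma discreteSupport {G : Type*} [Zero G] (g : ℝ → G) :
    DiscreteSupport fun t => if t ∈ crossings γ then g t else 0 := by
  intro t
  constructor
  · filter_upwards [A.right_not_mem_crossings t] with r hr using if_neg hr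
  · filter_upwards [A.left_not_mem_crossings t] with r hr using if_neg hr

/-- Subtracting `t * v` freezes the straight motion, so any function of the pentagon and the frozen
position can change only at crossings. The free `Ψ` serves for both data. -/
lemma hasJumps {G : Type*} [AddCommGroup G] (Ψ : ℤˣ → ℂ → G) :
    HasJumps (fun t => Ψ (A.εr t) (A.xr t - t * v))
      (fun t => Ψ (A.εr t) (A.xr t - t * v) - Ψ (A.εl t) (A.xl t - t * v)) := by
  intro t
  constructor
  · filter_upwards [A.right_step t] with r hr
    rw [hr.1, hr.2]
    congr 1; push_cast; ring
  · filter_upwards [A.left_step t] with r hr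
    rw [hr.1, hr.2]
    have : A.xl t - r * v - ((t - r : ℝ) : ℂ) * v = A.xl t - t * v := by push_cast; ring
    rw [this]; abel

lemma flight {a b : ℝ} (hab : a < b) (h : ∀ s, a < s → s < b → s ∉ crossings γ) :
    A.εl b = A.εr a ∧ A.xl b = A.xr a + ((b - a : ℝ) : ℂ) * v := by
  have key : ∀ {G : Type} [AddCommGroup G] (Ψ : ℤˣ → ℂ → G),
      Ψ (A.εl b) (A.xl b - b * v) = Ψ (A.εr a) (A.xr a - a * v) := by
    intro G _ Ψ
    have h1 := (A.hasJumps Ψ).sub_eq hab.le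
    rw [jumpSum_eq_single hab] at h1
    · rw [sub_right_inj] at h1
      exact h1.symm
    · intro s hs hs'
      obtain ⟨h2, h3⟩ := A.eq_of_not_mem_crossings (h s hs hs')
      rw [h2, h3, sub_self]
  refine ⟨Units.ext (key fun ε _ => (ε : ℤ)), ?_⟩
  have := key fun _ x => x
  push_cast
  linear_combination this

lemma exists_crossing_gt (t : ℝ) : ∃ s > t, s ∈ crossings γ := by
  by_contra! h
  have h0 := (A.flight (show t < t + 3 by linarith) fun s hs _ => h s hs).2
  have h1 := norm_le_of_mem_table (A.isAt_left (t + 3)).mem_table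
  have h2 := norm_le_of_mem_table (A.isAt_right t).mem_table
  have h3 : ‖((t + 3 - t : ℝ) : ℂ) * v‖ = 3 := by
    rw [norm_mul, A.unit, add_sub_cancel_left]; norm_num
  have h4 := norm_sub_le (A.xl (t + 3)) (A.xr t)
  rw [h0, add_sub_cancel_left, ← h0] at h4
  linarith

lemma finite_crossings (a b : ℝ) : (Set.Icc a b ∩ crossings γ).Finite := by
  classical
  have := (A.discreteSupport fun _ => (1 : ℕ)).finite a b
  refine this.subset fun s hs => ⟨hs.1, ?_⟩
  rw [Function.mem_support, if_pos hs.2]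
  exact one_ne_zero

lemma exists_next (t : ℝ) :
    ∃ s > t, s ∈ crossings γ ∧ ∀ r, t < r → r < s → r ∉ crossings γ := by
  obtain ⟨u, hu, hc⟩ := A.exists_crossing_gt t
  have hfin : (Set.Ioc t u ∩ crossings γ).Finite :=
    (A.finite_crossings t u).subset (Set.inter_subset_inter_left _ Set.Ioc_subset_Icc_self)
  obtain ⟨s, hs, hmin⟩ := Set.exists_min_image _ id hfin ⟨u, ⟨hu, le_rfl⟩, hc⟩
  refine ⟨s, hs.1.1, hs.2, fun r h1 h2 hr => ?_⟩
  exact absurd (hmin r ⟨⟨h1, h2.le.trans hs.1.2⟩, hr⟩) (not_le.2 h2)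

/-- The first crossing after the moment `t`. -/
def next (t : ℝ) : ℝ := (A.exists_next t).choose

lemma lt_next (t : ℝ) : t < A.next t := (A.exists_next t).choose_spec.1

lemma next_mem (t : ℝ) : A.next t ∈ crossings γ := (A.exists_next t).choose_spec.2.1

lemma not_mem_of_lt_next {t r : ℝ} (h : t < r) (h' : r < A.next t) : r ∉ crossings γ :=
  (A.exists_next t).choose_spec.2.2 r h h'

lemma next_eq {t s : ℝ} (h1 : t < s) (h2 : s ∈ crossings γ)
    (h3 : ∀ r, t < r → r < s → r ∉ crossings γ) : A.next t = s := by
  rcases lt_trichotomy (A.next t) s with h | h | h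
  · exact absurd (A.next_mem t) (h3 _ (A.lt_next t) h)
  · exact h
  · exact absurd h2 (A.not_mem_of_lt_next h1 h)

lemma right_periodic {T : ℝ} (hT : Function.Periodic γ T) :
    Function.Periodic A.εr T ∧ Function.Periodic A.xr T := by
  have : ∀ t, A.εr (t + T) = A.εr t ∧ A.xr (t + T) = A.xr t := by
    intro t
    refine A.right_unique ?_
    filter_upwards [A.right t] with r hr
    rwa [add_right_comm, hT]
  exact ⟨fun t => (this t).1, fun t => (this t).2⟩

omit A in
lemma crossings_periodic {T : ℝ} (hT : Function.Periodic γ T) (t : ℝ) :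
    t + T ∈ crossings γ ↔ t ∈ crossings γ := by
  rw [crossings, Set.mem_ofPred_eq, Set.mem_ofPred_eq, hT t]

omit A in
lemma sideLabel_periodic {T : ℝ} (hT : Function.Periodic γ T) :
    Function.Periodic (sideLabel γ) T := fun t => by
  have h := hT t
  unfold sideLabel
  revert h
  generalize γ (t + T) = a
  generalize γ t = b
  rintro rfl
  rfl

lemma next_periodic {T : ℝ} (hT : Function.Periodic γ T) (t : ℝ) :
    A.next (t + T) = A.next t + T := by
  refine A.next_eq (by linarith [A.lt_next t]) ((crossings_periodic hT _).2 (A.next_mem t)) ?_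
  intro r h1 h2
  rw [← sub_add_cancel r T, crossings_periodic hT]
  exact A.not_mem_of_lt_next (t := t) (by linarith) (by linarith)

lemma next_right (t : ℝ) : ∀ᶠ r in 𝓝[>] (0 : ℝ), A.next (t + r) = A.next t := by
  refine eventually_pos_iff.2 ⟨A.next t - t, by linarith [A.lt_next t], fun r h0 h1 => ?_⟩
  exact A.next_eq (by linarith) (A.next_mem t) fun s hs hs' =>
    A.not_mem_of_lt_next (by linarith) hs'

lemma next_left (t : ℝ) :
    ∀ᶠ r in 𝓝[>] (0 : ℝ), (t ∈ crossings γ → A.next (t - r) = t) ∧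
      (t ∉ crossings γ → A.next (t - r) = A.next t) := by
  obtain ⟨δ, hδ, h⟩ := eventually_pos_iff.1 (A.left_not_mem_crossings t)
  refine eventually_pos_iff.2 ⟨δ, hδ, fun r h0 h1 => ?_⟩
  have h2 : ∀ s, t - r < s → s < t → s ∉ crossings γ := by
    intro s hs hs'
    rw [← sub_sub_cancel t s]
    exact h (t - s) (by linarith) (by linarith)
  refine ⟨fun hc => A.next_eq (by linarith) hc h2, fun hc => ?_⟩
  refine A.next_eq (by linarith [A.lt_next t]) (A.next_mem t) fun s hs hs' => ?_
  rcases lt_trichotomy s t with h | rfl | h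
  exacts [h2 s hs h, hc, A.not_mem_of_lt_next h hs']

end Lift

/-! ### Folding maps -/

/-- The map that folds the pentagon `table ε` onto the pentagon `table ε₀`: a rotation by `root k`,
preceded by the reflection in the real axis if the pentagons differ. -/
def fold (ε₀ ε : ℤˣ) (k : ZMod 5) : ℂ →ₗ[ℝ] ℂ :=
  if ε = ε₀ then LinearMap.mulLeft ℝ (root k : ℂ)
  else (LinearMap.mulLeft ℝ (root k : ℂ)).comp Complex.conjAe.toLinearMap

lemma fold_self (ε₀ : ℤˣ) (k : ZMod 5) (x : ℂ) : fold ε₀ ε₀ k x = root k * x := by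
  simp [fold]

lemma fold_neg (ε₀ : ℤˣ) (k : ZMod 5) (x : ℂ) : fold ε₀ (-ε₀) k x = root k * conj x := by
  simp [fold]

/-- The action of `fold` on the labels. -/
def foldLabel (ε₀ ε : ℤˣ) (k a : ZMod 5) : ZMod 5 := if ε = ε₀ then a + k else k + 1 - a

lemma fold_vertex (ε₀ ε : ℤˣ) (k a : ZMod 5) :
    fold ε₀ ε k (vertex ε a) = vertex ε₀ (foldLabel ε₀ ε k a) := by
  by_cases h : ε = ε₀
  · subst h
    rw [fold_self, foldLabel, if_pos rfl, vertex, vertex, V_eq, V_eq,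
      show a + k + 2 = k + (a + 2) by ring, coe_root_add k]
    ring
  · obtain rfl := eq_neg_of_ne h
    -- Conjugation sends the factor `I` to `-I`, which absorbs the sign of the opposite pentagon; on
    -- labels it is `a ↦ 1 - a`.
    rw [fold_neg, foldLabel, if_neg (neg_sign_ne _), vertex, vertex, V_eq, V_eq,
      show k + 1 - a + 2 = k + -(a + 2) by ring_nf; rfl, coe_root_add k, map_mul, map_mul, conj_root,
      Complex.conj_I]
    simp
    ring

lemma foldLabel_surjective (ε₀ ε : ℤˣ) (k : ZMod 5) :
    Function.Surjective (foldLabel ε₀ ε k) := by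
  intro b
  by_cases h : ε = ε₀
  · exact ⟨b - k, by simp [foldLabel, h]⟩
  · exact ⟨k + 1 - b, by simp [foldLabel, h]⟩

lemma inner_fold (ε₀ ε : ℤˣ) (k : ZMod 5) (x y : ℂ) :
    inner ℝ (fold ε₀ ε k x) (fold ε₀ ε k y) = inner ℝ x y := by
  have h : (root k : ℂ) * root (-k) = 1 := by
    rw [← coe_root_add, add_neg_cancel, root_zero, Circle.coe_one]
  by_cases hε : ε = ε₀
  · subst hε
    rw [fold_self, fold_self, Complex.inner, Complex.inner, map_mul, conj_root]
    congr 1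
    linear_combination (y * conj x) * h
  · obtain rfl := eq_neg_of_ne hε
    rw [fold_neg, fold_neg, Complex.inner, Complex.inner, map_mul, conj_root, Complex.conj_conj,
      ← Complex.conj_re]
    congr 1
    simp only [map_mul, conj_root, neg_neg, Complex.conj_conj]
    linear_combination (y * conj x) * h

lemma norm_fold (ε₀ ε : ℤˣ) (k : ZMod 5) (x : ℂ) : ‖fold ε₀ ε k x‖ = ‖x‖ := by
  have h := inner_fold ε₀ ε k x x
  rw [real_inner_self_eq_norm_sq, real_inner_self_eq_norm_sq] at h
  exact (sq_eq_sq₀ (norm_nonneg _) (norm_nonneg _)).1 h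

lemma fold_injective (ε₀ ε : ℤˣ) (k : ZMod 5) : Function.Injective (fold ε₀ ε k) := by
  rw [injective_iff_map_eq_zero]
  intro x hx
  rw [← norm_eq_zero, ← norm_fold ε₀ ε k, hx, norm_zero]

lemma fold_mem_table {ε₀ ε : ℤˣ} {k : ZMod 5} {x : ℂ} (hx : x ∈ table ε) :
    fold ε₀ ε k x ∈ table ε₀ := by
  obtain ⟨w, h0, h1, rfl⟩ := exists_weights hx
  simp_rw [map_sum, map_smul, fold_vertex]
  refine (show Convex ℝ (table ε₀) from convex_convexHull ℝ _).sum_mem (fun i _ => h0 i) h1 fun i _ => ?_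
  exact vertex_mem_table _ _

lemma fold_mem_side_iff {ε₀ ε : ℤˣ} {k j : ZMod 5} {x : ℂ} (hx : x ∈ table ε) :
    fold ε₀ ε k x ∈ side ε₀ (foldLabel ε₀ ε k j) ↔ x ∈ side ε j := by
  rw [mem_side_iff, mem_side_iff, ← fold_vertex, inner_fold]
  simp [hx, fold_mem_table hx]

lemma fold_mirror_eq (ε₀ ε : ℤˣ) (k j : ZMod 5) (x : ℂ) :
    fold ε₀ ε k (mirror j x) = mirror (foldLabel ε₀ ε k j) (fold ε₀ ε k x) := by
  rw [mirror_eq ε, mirror_eq ε₀, map_sub, map_smul, ← fold_vertex, inner_fold]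

/-- The change of the rotation `k` at a crossing of the side `j` after which the trajectory is in
the pentagon `table ε`. -/
def turn (ε₀ ε : ℤˣ) (j : ZMod 5) : ZMod 5 := if ε = ε₀ then 1 - 2 * j else 2 * j - 1

/-- Conjugation in the fold cancels the one in the mirror, leaving a rotation that `turn`
compensates. Applied to positions this gives continuity of the folded path, applied to velocities
the reflection law. -/
lemma fold_cross (ε₀ ε : ℤˣ) (k j : ZMod 5) (x : ℂ) :
    fold ε₀ (-ε) (k + turn ε₀ (-ε) j) (mirror j x) = fold ε₀ ε k x := by
  by_cases hε : ε = ε₀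
  · subst hε
    rw [fold_neg, fold_self, turn, if_neg (neg_sign_ne _), mirror, map_mul, conj_root,
      Complex.conj_conj, ← mul_assoc, ← coe_root_add, add_neg_cancel_right]
  · obtain rfl := eq_neg_of_ne hε
    rw [neg_neg, fold_neg, fold_self, turn, if_pos rfl, mirror, ← mul_assoc, ← coe_root_add,
      show k + (1 - 2 * j) + (2 * j - 1) = k by ring]

lemma fold_add (ε₀ ε : ℤˣ) (k a : ZMod 5) (x : ℂ) :
    fold ε₀ ε (k + a) x = root a * fold ε₀ ε k x := by
  by_cases hε : ε = ε₀
  · subst hε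
    rw [fold_self, fold_self, coe_root_add]; ring
  · obtain rfl := eq_neg_of_ne hε
    rw [fold_neg, fold_neg, coe_root_add]; ring

/-! ### Uniqueness of billiard trajectories -/

lemma eventually_nonneg_of_pos {p : ℝ → Prop} (h0 : p 0) (h : ∀ᶠ r in 𝓝[>] (0 : ℝ), p r) :
    ∀ᶠ r in 𝓝[≥] (0 : ℝ), p r := by
  obtain ⟨δ, hδ, h⟩ := eventually_pos_iff.1 h
  refine eventually_nonneg_iff.2 ⟨δ, hδ, fun r hr h1 => ?_⟩
  rcases hr.eq_or_lt with rfl | hr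
  exacts [h0, h r hr h1]

lemma eventually_nonpos_of_pos {p : ℝ → Prop} (h0 : p 0) (h : ∀ᶠ r in 𝓝[>] (0 : ℝ), p (-r)) :
    ∀ᶠ r in 𝓝[≤] (0 : ℝ), p r := by
  obtain ⟨δ, hδ, h⟩ := eventually_pos_iff.1 h
  refine eventually_nonpos_iff.2 ⟨δ, hδ, fun r hr h1 => ?_⟩
  rcases hr.eq_or_lt with rfl | hr
  exacts [by simpa using h0, h r hr h1]

/-- A billiard trajectory is determined by its germ at one moment. -/
lemma IsBilliardTrajectory.unique {ε : ℤˣ} {β β' : ℝ → ℂ} (h : IsBilliardTrajectory ε β)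
    (h' : IsBilliardTrajectory ε β') (h0 : ∀ᶠ r in 𝓝[>] (0 : ℝ), β r = β' r) : β = β' := by
  let U : Set ℝ := {t | ∀ᶠ s in 𝓝 t, β s = β' s}
  have hopen : IsOpen U := isOpen_setOfPred_eventually_nhds
  -- On each side of `t` both trajectories are affine. Agreement near a close `s` identifies the
  -- affine pieces on that side, and the reflection law, being invertible, carries the agreement
  -- through `t`. Hence `U` is closed.
  have hnear : ∀ t, ∀ᶠ s in 𝓝 t, s ∈ U → t ∈ U := by
    intro t
    obtain ⟨-, -, u, w, hu, hw, hl, hr, hin, hside⟩ := h t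
    obtain ⟨-, -, u', w', hu', hw', hl', hr', hin', hside'⟩ := h' t
    have hloc : β t = β' t → u = u' → w = w' → t ∈ U := by
      rintro e rfl rfl
      refine eventually_nhds_of_nonneg_of_nonpos ?_ ?_
      · filter_upwards [hr, hr'] with r h1 h2
        rw [h1, h2, e]
      · filter_upwards [hl, hl'] with r h1 h2
        rw [h1, h2, e]
    have hw_eq : β t = β' t → u = u' → w = w' := by
      rintro e rfl
      by_cases hs : ∃ j, β t ∈ side ε j
      · obtain ⟨j, hj⟩ := hs
        rw [hside j hj, hside' j (e ▸ hj)]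
      · push Not at hs
        rw [hin hs, hin' (e ▸ hs)]
    have hu_eq : β t = β' t → w = w' → u = u' := by
      rintro e rfl
      by_cases hs : ∃ j, β t ∈ side ε j
      · obtain ⟨j, hj⟩ := hs
        have := (hside j hj).symm.trans (hside' j (e ▸ hj))
        exact LinearIsometryEquiv.injective _ this
      · push Not at hs
        rw [← hin hs, hin' (e ▸ hs)]
    have haff : ∀ {a b c d : ℂ} {s : ℝ},
        (∀ᶠ r : ℝ in 𝓝 s, a + (r : ℂ) * b = c + (r : ℂ) * d) → a = c ∧ b = d := by
      intro a b c d s hs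
      obtain ⟨δ, hδ, hs⟩ := Metric.eventually_nhds_iff.1 hs
      have h1 := hs (show dist s s < δ by simpa using hδ)
      have h2 := hs (show dist (s + δ / 2) s < δ by
        rw [Real.dist_eq, add_sub_cancel_left, abs_of_pos (by linarith)]; linarith)
      have hb : ((δ / 2 : ℝ) : ℂ) * (b - d) = 0 := by
        push_cast at h2 ⊢
        linear_combination h2 - h1
      have hbd : b = d := by
        rcases mul_eq_zero.1 hb with h | h
        · exact absurd (Complex.ofReal_eq_zero.1 h) (by linarith)
        · exact sub_eq_zero.1 h
      subst hbd
      exact ⟨add_right_cancel h1, rfl⟩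
    have hshift : ∀ {r : ℝ}, t + r ∈ U → ∀ᶠ q in 𝓝 r, β (t + q) = β' (t + q) := by
      intro r hr
      exact (show Filter.Tendsto (fun q => t + q) (𝓝 r) (𝓝 (t + r)) from
        (continuous_const.add continuous_id).tendsto r).eventually hr
    obtain ⟨a, ha, h1⟩ := eventually_nonneg_iff.1 (hr.and hr')
    obtain ⟨b, hb, h2⟩ := eventually_nonpos_iff.1 (hl.and hl')
    filter_upwards [Ioo_mem_nhds (show t - b < t by linarith) (show t < t + a by linarith)]
      with s hs hsU
    rcases lt_trichotomy s t with hlt | heq | hlt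
    · have := hshift (r := s - t) (by simpa using hsU)
      have key : ∀ᶠ q : ℝ in 𝓝 (s - t), β t + (q : ℂ) * u = β' t + (q : ℂ) * u' := by
        filter_upwards [this, Ioo_mem_nhds (show -b < s - t by linarith [hs.1])
          (show s - t < 0 by linarith)] with q h3 h4
        have h5 := h2 (-q) (by linarith [h4.2]) (by linarith [h4.1])
        rw [neg_neg] at h5
        rw [← h5.1, ← h5.2, h3]
      obtain ⟨e1, e2⟩ := haff key
      exact hloc e1 e2 (hw_eq e1 e2)
    · exact heq ▸ hsU
    · have := hshift (r := s - t) (by simpa using hsU)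
      have key : ∀ᶠ q : ℝ in 𝓝 (s - t), β t + (q : ℂ) * w = β' t + (q : ℂ) * w' := by
        filter_upwards [this, Ioo_mem_nhds (show 0 < s - t by linarith)
          (show s - t < a by linarith [hs.2])] with q h3 h4
        have h5 := h1 q h4.1.le h4.2
        rw [← h5.1, ← h5.2, h3]
      obtain ⟨e1, e2⟩ := haff key
      exact hloc e1 (hu_eq e1 e2) e2
  have hclosed : IsClosed U := by
    rw [isClosed_iff_frequently]
    intro t ht
    obtain ⟨s, h1, h2⟩ := (ht.and_eventually (hnear t)).exists
    exact h2 h1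
  obtain ⟨δ, hδ, h1⟩ := eventually_pos_iff.1 h0
  have hne : δ / 2 ∈ U := by
    filter_upwards [Ioo_mem_nhds (show 0 < δ / 2 by linarith) (show δ / 2 < δ by linarith)]
      with s hs using h1 s hs.1 hs.2
  have huniv : U = Set.univ := IsClopen.eq_univ ⟨hclosed, hopen⟩ ⟨_, hne⟩
  funext t
  have : t ∈ U := huniv ▸ Set.mem_univ t
  exact this.self_of_nhds

/-! ### The folded trajectory is a billiard trajectory -/

namespace Lift

variable {v : ℂ} {γ : ℝ → DoublePentagon} (A : Lift v γ) (ε₀ : ℤˣ)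

open Classical in
/-- The change of the rotation at the moment `t`. -/
def jump (t : ℝ) : ZMod 5 := if t ∈ crossings γ then turn ε₀ (A.εr t) (sideLabel γ t) else 0

/-- The rotation in the folding map at the moment `t`. -/
def rot (t : ℝ) : ZMod 5 := cumulative (A.jump ε₀) t

lemma hasJumps_rot : HasJumps (A.rot ε₀) (A.jump ε₀) :=
  hasJumps_cumulative (A.discreteSupport _)

lemma rot_zero : A.rot ε₀ 0 = 0 := by
  rw [rot, cumulative, sub_self]

/-- The billiard trajectory obtained by folding. -/
def billiard (t : ℝ) : ℂ := fold ε₀ (A.εr t) (A.rot ε₀ t) (A.xr t)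

lemma billiard_right (t : ℝ) : ∀ᶠ r : ℝ in 𝓝[>] (0 : ℝ),
    A.billiard ε₀ (t + r) = A.billiard ε₀ t + (r : ℂ) * fold ε₀ (A.εr t) (A.rot ε₀ t) v := by
  filter_upwards [A.right_step t, (A.hasJumps_rot ε₀ t).1] with r h1 h2
  rw [billiard, billiard, h1.1, h1.2, h2, map_add, ← Complex.real_smul, map_smul,
    Complex.real_smul]

-- `rot` is right-continuous, so the rotation just before `t` is `rot t - jump t`. At a crossing the
-- old fold is the new fold after the mirror.
open Classical in
lemma fold_left (t : ℝ) (x : ℂ) :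
    fold ε₀ (A.εl t) (A.rot ε₀ t - A.jump ε₀ t) x =
      fold ε₀ (A.εr t) (A.rot ε₀ t) (if t ∈ crossings γ then mirror (sideLabel γ t) x else x) := by
  by_cases h : t ∈ crossings γ
  · rw [if_pos h, (A.cross h).1, ← fold_cross, jump, if_pos h, (A.cross h).1, sub_add_cancel]
  · rw [if_neg h, (A.eq_of_not_mem_crossings h).1, jump, if_neg h, sub_zero]

lemma fold_left_xl (t : ℝ) :
    fold ε₀ (A.εl t) (A.rot ε₀ t - A.jump ε₀ t) (A.xl t) = A.billiard ε₀ t := by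
  rw [fold_left, billiard]
  split_ifs with h
  · rw [(A.cross h).2]
  · rw [(A.eq_of_not_mem_crossings h).2]

lemma billiard_left (t : ℝ) : ∀ᶠ r : ℝ in 𝓝[>] (0 : ℝ), A.billiard ε₀ (t - r) =
    A.billiard ε₀ t - (r : ℂ) * fold ε₀ (A.εl t) (A.rot ε₀ t - A.jump ε₀ t) v := by
  filter_upwards [A.left_step t, (A.hasJumps_rot ε₀ t).2] with r h1 h2
  rw [← A.fold_left_xl ε₀ t, billiard, h1.1, h1.2, eq_sub_of_add_eq h2.symm, map_sub, ← Complex.real_smul,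
    map_smul, Complex.real_smul]

lemma billiard_mem_side_iff (t : ℝ) :
    (∃ j, A.billiard ε₀ t ∈ side ε₀ j) ↔ t ∈ crossings γ := by
  rw [A.mem_crossings_iff (A.isAt_right t),
    (foldLabel_surjective ε₀ (A.εr t) (A.rot ε₀ t)).exists]
  exact exists_congr fun j => fold_mem_side_iff (A.isAt_right t).mem_table

lemma isBilliardTrajectory : IsBilliardTrajectory ε₀ (A.billiard ε₀) := by
  intro t
  have ht := (A.isAt_right t).mem_table
  refine ⟨fold_mem_table ht, fun j hj => ?_, fold ε₀ (A.εl t) (A.rot ε₀ t - A.jump ε₀ t) v,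
    fold ε₀ (A.εr t) (A.rot ε₀ t) v, by rw [norm_fold, A.unit], by rw [norm_fold, A.unit],
    ?_, ?_, fun h => ?_, fun j hj => ?_⟩
  · obtain ⟨a, rfl⟩ := foldLabel_surjective ε₀ (A.εr t) (A.rot ε₀ t) j
    rw [billiard, ← fold_vertex] at hj
    exact A.traj.ne_vertex (A.isAt_right t) a (fold_injective _ _ _ hj)
  · refine eventually_nonpos_of_pos (by simp) ?_
    filter_upwards [A.billiard_left ε₀ t] with r hr
    rw [← sub_eq_add_neg, hr, Complex.ofReal_neg, neg_mul, sub_eq_add_neg]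
  · exact eventually_nonneg_of_pos (by simp) (A.billiard_right ε₀ t)
  · rw [← not_exists, billiard_mem_side_iff] at h
    rw [fold_left, if_neg h]
  · have h := (A.billiard_mem_side_iff ε₀ t).1 ⟨j, hj⟩
    obtain ⟨i, rfl⟩ := foldLabel_surjective ε₀ (A.εr t) (A.rot ε₀ t) j
    rw [billiard, fold_mem_side_iff ht, ← A.traj.onSide_iff (A.isAt_right t)] at hj
    rw [reflection_eq_mirror, fold_left, if_pos h, A.sideLabel_eq hj, ← fold_mirror_eq,
      mirror_mirror]

end Lift

/-! ### Parity of crossings and periods -/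

open Classical in
lemma jumpSum_ite {G : Type*} [AddCommGroup G] {C : Set ℝ} (g : ℝ → G) {a b : ℝ}
    (hC : (Set.Ioc a b ∩ C).Finite) :
    jumpSum (fun t => if t ∈ C then g t else 0) a b = ∑ t ∈ hC.toFinset, g t := by
  rw [jumpSum, finsum_mem_eq_sum_of_inter_support_eq (t := hC.toFinset)]
  · refine Finset.sum_congr rfl fun t ht => if_pos ?_
    exact ((Set.Finite.mem_toFinset _).1 ht).2
  · ext t
    simp only [Set.mem_inter_iff, Function.mem_support, Set.Finite.coe_toFinset]
    constructor
    · rintro ⟨h1, h2⟩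
      refine ⟨⟨h1, ?_⟩, h2⟩
      by_contra h3
      exact h2 (if_neg h3)
    · rintro ⟨⟨h1, _⟩, h2⟩
      exact ⟨h1, h2⟩

/-- Reflections and pairs are counted on `[0, T)`, whereas jump sums run over `(0, T]`. -/
lemma ncard_Ico_eq_ncard_Ioc {p : ℝ → Prop} {T : ℝ} (hT : 0 < T) (hp : p 0 ↔ p T)
    (hfin : {t | t ∈ Set.Ioo 0 T ∧ p t}.Finite) :
    {t | t ∈ Set.Ico 0 T ∧ p t}.ncard = {t | t ∈ Set.Ioc 0 T ∧ p t}.ncard := by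
  by_cases h : p 0
  · have h1 : {t | t ∈ Set.Ico 0 T ∧ p t} = insert 0 {t | t ∈ Set.Ioo 0 T ∧ p t} := by
      ext t
      simp only [Set.mem_ofPred_eq, Set.mem_insert_iff, Set.mem_Ico, Set.mem_Ioo]
      constructor
      · rintro ⟨⟨h1, h2⟩, h3⟩
        rcases h1.eq_or_lt with h4 | h4
        exacts [Or.inl h4.symm, Or.inr ⟨⟨h4, h2⟩, h3⟩]
      · rintro (rfl | ⟨⟨h1, h2⟩, h3⟩)
        exacts [⟨⟨le_rfl, hT⟩, h⟩, ⟨⟨h1.le, h2⟩, h3⟩]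
    have h2 : {t | t ∈ Set.Ioc 0 T ∧ p t} = insert T {t | t ∈ Set.Ioo 0 T ∧ p t} := by
      ext t
      simp only [Set.mem_ofPred_eq, Set.mem_insert_iff, Set.mem_Ioc, Set.mem_Ioo]
      constructor
      · rintro ⟨⟨h1, h2⟩, h3⟩
        rcases h2.eq_or_lt with h4 | h4
        exacts [Or.inl h4, Or.inr ⟨⟨h1, h4⟩, h3⟩]
      · rintro (rfl | ⟨⟨h1, h2⟩, h3⟩)
        exacts [⟨⟨hT, le_rfl⟩, hp.1 h⟩, ⟨⟨h1, h2.le⟩, h3⟩]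
    rw [h1, h2, Set.ncard_insert_of_notMem (fun h => lt_irrefl _ h.1.1) hfin,
      Set.ncard_insert_of_notMem (fun h => lt_irrefl _ h.1.2) hfin]
  · congr 1
    ext t
    simp only [Set.mem_ofPred_eq, Set.mem_Ico, Set.mem_Ioc]
    constructor
    · rintro ⟨⟨h1, h2⟩, h3⟩
      rcases h1.eq_or_lt with rfl | h4
      exacts [absurd h3 h, ⟨⟨h4, h2.le⟩, h3⟩]
    · rintro ⟨⟨h1, h2⟩, h3⟩
      rcases h2.eq_or_lt with rfl | h4
      exacts [absurd (hp.2 h3) h, ⟨⟨h1.le, h4⟩, h3⟩]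

namespace Lift

variable {v : ℂ} {γ : ℝ → DoublePentagon} (A : Lift v γ) (ε₀ : ℤˣ)

include A in
lemma finite_crossings_Ioc (a b : ℝ) : (Set.Ioc a b ∩ crossings γ).Finite :=
  (A.finite_crossings a b).subset (Set.inter_subset_inter_left _ Set.Ioc_subset_Icc_self)

open Classical in
/-- The pentagons alternate. -/
lemma hasJumps_sign (η : ℤˣ) : HasJumps (fun t => if A.εr t = η then (0 : ZMod 2) else 1)
    (fun t => if t ∈ crossings γ then 1 else 0) := by
  have h1 := A.hasJumps fun ε _ => if ε = η then (0 : ZMod 2) else 1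
  have h2 : (fun t => (if A.εr t = η then (0 : ZMod 2) else 1) -
      if A.εl t = η then (0 : ZMod 2) else 1) =
      fun t => if t ∈ crossings γ then 1 else 0 := by
    funext t
    by_cases ht : t ∈ crossings γ
    · rw [if_pos ht, (A.cross ht).1]
      by_cases h : A.εl t = η
      · rw [if_pos h, h, if_neg (neg_sign_ne _)]; rfl
      · rw [if_neg h, eq_neg_of_ne h, neg_neg, if_pos rfl]; rfl
    · rw [if_neg ht, (A.eq_of_not_mem_crossings ht).1, sub_self]
  rwa [h2] at h1

lemma even_ncard_iff {a b : ℝ} (hab : a ≤ b) :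
    Even (Set.Ioc a b ∩ crossings γ).ncard ↔ A.εr b = A.εr a := by
  classical
  have h1 := (A.hasJumps_sign (A.εr a)).sub_eq hab
  rw [jumpSum_ite _ (A.finite_crossings_Ioc a b), if_pos rfl, sub_zero, Finset.sum_const,
    nsmul_one, ← Set.ncard_eq_toFinset_card _ (A.finite_crossings_Ioc a b)] at h1
  rw [← ZMod.natCast_eq_zero_iff_even, ← h1]
  split_ifs with h <;> simp [h]

lemma jump_periodic {T : ℝ} (hT : Function.Periodic γ T) : Function.Periodic (A.jump ε₀) T := by
  intro t
  rw [jump, jump, (A.right_periodic hT).1, sideLabel_periodic hT]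
  classical exact if_congr (crossings_periodic hT t) rfl rfl

end Lift

lemma HasJumps.comp_add {G : Type*} [AddCommGroup G] {f J : ℝ → G} (h : HasJumps f J) (T : ℝ) :
    HasJumps (fun t => f (t + T)) (fun t => J (t + T)) := by
  intro t
  constructor
  · filter_upwards [(h (t + T)).1] with r hr
    rw [← hr]; congr 1; ring
  · filter_upwards [(h (t + T)).2] with r hr
    rw [hr]; congr 2; ring

/-- The difference of `f` and its translate has no jumps, hence is constant. -/
lemma HasJumps.add_period {G : Type*} [AddCommGroup G] {f J : ℝ → G} (h : HasJumps f J) {T : ℝ}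
    (hJ : Function.Periodic J T) (t : ℝ) : f (t + T) = f t + (f T - f 0) := by
  have hs : HasJumps (fun t => f (t + T) - f t) 0 := by
    intro t
    constructor
    · filter_upwards [(h t).1, (h.comp_add T t).1] with r h1 h2
      rw [h1, h2]
    · filter_upwards [(h t).2, (h.comp_add T t).2] with r h1 h2
      rw [h1, h2, hJ t, Pi.zero_apply]; abel
  have key : f (t + T) - f t = f (0 + T) - f 0 := by
    rcases le_total 0 t with h0 | h0
    · have := hs.sub_eq h0
      rw [jumpSum_eq_zero (J := 0) fun _ _ _ => rfl] at this
      exact sub_eq_zero.1 this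
    · have := hs.sub_eq h0
      rw [jumpSum_eq_zero (J := 0) fun _ _ _ => rfl] at this
      exact (sub_eq_zero.1 this).symm
  rw [zero_add] at key
  rw [← key]; abel

namespace Lift

variable {v : ℂ} {γ : ℝ → DoublePentagon} (A : Lift v γ) (ε₀ : ℤˣ)

lemma rot_add_period {T : ℝ} (hT : Function.Periodic γ T) (t : ℝ) :
    A.rot ε₀ (t + T) = A.rot ε₀ t + A.rot ε₀ T := by
  rw [(A.hasJumps_rot ε₀).add_period (A.jump_periodic ε₀ hT), rot_zero, sub_zero]

lemma rot_nat_mul {T : ℝ} (hT : Function.Periodic γ T) (n : ℕ) :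
    A.rot ε₀ (n * T) = n * A.rot ε₀ T := by
  induction n with
  | zero => simp [rot_zero]
  | succ n ih =>
    push_cast
    rw [add_mul, one_mul, A.rot_add_period ε₀ hT, ih]; ring

/-- A period of the trajectory without rotation is an even period of the folded trajectory. -/
lemma isEvenPeriod_of_periodic {T : ℝ} (hT0 : 0 < T) (hT : Function.Periodic γ T)
    (h : A.rot ε₀ T = 0) : IsEvenPeriod ε₀ (A.billiard ε₀) T := by
  refine ⟨hT0, fun t => ?_, ?_⟩
  · rw [billiard, billiard, (A.right_periodic hT).1, (A.right_periodic hT).2,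
      A.rot_add_period ε₀ hT, h, add_zero]
  · simp only [billiard_mem_side_iff]
    have hfin := A.finite_crossings_Ioc 0 T
    rw [ncard_Ico_eq_ncard_Ioc hT0 (by simpa using (crossings_periodic hT 0).symm)
      (hfin.subset fun t ht => ⟨⟨ht.1.1, ht.1.2.le⟩, ht.2⟩)]
    refine (A.even_ncard_iff hT0.le).2 ?_
    simpa using (A.right_periodic hT).1 0

/-- An even period of the folded trajectory is a period of the trajectory. -/
lemma periodic_of_isEvenPeriod {T : ℝ} (h : IsEvenPeriod ε₀ (A.billiard ε₀) T) :
    Function.Periodic γ T ∧ A.rot ε₀ T = 0 := by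
  obtain ⟨hT0, hT, heven⟩ := h
  simp only [billiard_mem_side_iff] at heven
  have hc : ∀ t, t + T ∈ crossings γ ↔ t ∈ crossings γ := by
    intro t
    rw [← A.billiard_mem_side_iff ε₀, ← A.billiard_mem_side_iff ε₀, hT]
  rw [ncard_Ico_eq_ncard_Ioc hT0 (by simpa using (hc 0).symm)
    ((A.finite_crossings_Ioc 0 T).subset fun t ht => ⟨⟨ht.1.1, ht.1.2.le⟩, ht.2⟩)] at heven
  have hε0 : A.εr T = A.εr 0 := (A.even_ncard_iff hT0.le).1 heven
  have hε : ∀ t, A.εr (t + T) = A.εr t := by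
    classical
    intro t
    have hp : Function.Periodic (fun s => if s ∈ crossings γ then (1 : ZMod 2) else 0) T :=
      fun s => if_congr (hc s) rfl rfl
    have := (A.hasJumps_sign (A.εr t)).add_period hp t
    simp only [hε0, sub_self, add_zero, if_pos] at this
    by_contra h
    rw [if_neg h] at this
    exact one_ne_zero this
  -- The folded velocities at `t` and `t + T` agree and come from the same pentagon, so they differ
  -- only by a power of the root of unity, which must be 1.
  have hvel : ∀ t, A.rot ε₀ (t + T) = A.rot ε₀ t := by
    intro t
    obtain ⟨r, ⟨hr, hr'⟩, hpos⟩ := (((A.billiard_right ε₀ (t + T)).and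
      (A.billiard_right ε₀ t)).and (eventually_pos_iff.2 ⟨1, one_pos, fun r h _ => h⟩)).exists
    rw [add_right_comm, hT, hT, hr', hε] at hr
    have hr0 : (r : ℂ) ≠ 0 := Complex.ofReal_ne_zero.2 hpos.ne'
    have e := mul_left_cancel₀ hr0 (add_left_cancel hr)
    rw [show A.rot ε₀ (t + T) = A.rot ε₀ t + (A.rot ε₀ (t + T) - A.rot ε₀ t) by ring,
      fold_add] at e
    have hne : fold ε₀ (A.εr t) (A.rot ε₀ t) v ≠ 0 := by
      rw [← norm_ne_zero_iff, norm_fold, A.unit]; exact one_ne_zero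
    have h1 := mul_right_cancel₀ hne ((one_mul _).trans e)
    have h2 : root (A.rot ε₀ (t + T) - A.rot ε₀ t) = root 0 := by
      rw [root_zero]; exact Circle.ext (by rw [← h1]; rfl)
    exact sub_eq_zero.1 (root_injective h2)
  refine ⟨fun t => ?_, by simpa [rot_zero] using hvel 0⟩
  have hx : A.xr (t + T) = A.xr t := by
    have := hT t
    rw [billiard, billiard, hvel, hε] at this
    exact fold_injective _ _ _ this
  have h1 := A.isAt_right (t + T)
  rw [hε, hx] at h1
  exact h1.eq_of_isAt (A.isAt_right t)

end Lift

/-! ### Directions in a sector and the possible passages -/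

lemma vertex_add_label (ε : ℤˣ) (m a : ZMod 5) : vertex ε (m + a) = root a * vertex ε m := by
  rw [vertex, vertex, V_eq, V_eq, show m + a + 2 = a + (m + 2) by ring, coe_root_add a]; ring

lemma inner_rotated (v n : ℂ) (a : ZMod 5) :
    inner ℝ v (root a * n) =
      (root a : ℂ).re * inner ℝ v n + (root a : ℂ).im * inner ℝ v (Complex.I * n) := by
  simp only [Complex.inner, Complex.mul_re, Complex.mul_im, Complex.conj_re, Complex.conj_im,
    Complex.I_re, Complex.I_im]
  ring

lemma root_re_sq_add_im_sq (a : ZMod 5) : (root a : ℂ).re ^ 2 + (root a : ℂ).im ^ 2 = 1 := by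
  have := Complex.normSq_eq_norm_sq (root a : ℂ)
  rw [Circle.norm_coe, Complex.normSq_apply] at this
  linarith

lemma inner_sq_add_inner_sq {v n : ℂ} (hv : ‖v‖ = 1) (hn : ‖n‖ = 1) :
    (inner ℝ v n : ℝ) ^ 2 + (inner ℝ v (Complex.I * n) : ℝ) ^ 2 = 1 := by
  have h1 := Complex.normSq_eq_norm_sq v
  have h2 := Complex.normSq_eq_norm_sq n
  rw [hv, Complex.normSq_apply] at h1
  rw [hn, Complex.normSq_apply] at h2
  simp only [Complex.inner, Complex.mul_re, Complex.mul_im, Complex.conj_re, Complex.conj_im,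
    Complex.I_re, Complex.I_im]
  have : (v.re * v.re + v.im * v.im) * (n.re * n.re + n.im * n.im) = 1 := by rw [h1, h2]; norm_num
  linear_combination this

lemma cos_pi_div_ten_sq : Real.cos (Real.pi / 10) ^ 2 = (1 + inradius) / 2 := by
  rw [Real.cos_sq, inradius, show 2 * (Real.pi / 10) = Real.pi / 5 by ring]; ring

lemma cos_pi_div_ten_pos : 0 < Real.cos (Real.pi / 10) :=
  Real.cos_pos_of_mem_Ioo ⟨by linarith [Real.pi_pos], by linarith [Real.pi_pos]⟩

section Sector

variable {v : ℂ} {η : ℤˣ} {m : ZMod 5}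

lemma inner_sq_le (hm : inner ℝ v (vertex η m) ≤ -Real.cos (Real.pi / 10)) :
    (1 + inradius) / 2 ≤ (inner ℝ v (vertex η m) : ℝ) ^ 2 := by
  rw [← cos_pi_div_ten_sq, ← neg_sq (inner ℝ v (vertex η m) : ℝ)]
  exact pow_le_pow_left₀ cos_pi_div_ten_pos.le (by linarith) 2

/-- `v` is within π/10 of the direction opposite to vertex `m`, and the vertices `m ± 1` are at
angle π/5 from that direction. -/
lemma inner_pos_of_sector (hv : ‖v‖ = 1)
    (hm : inner ℝ v (vertex η m) ≤ -Real.cos (Real.pi / 10)) {a : ZMod 5}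
    (ha : (root a : ℂ).re = -inradius) : (0 : ℝ) < inner ℝ v (vertex η (m + a)) := by
  have h1 := inner_sq_le hm
  have h2 := root_re_sq_add_im_sq a
  have h3 := inner_sq_add_inner_sq hv (norm_vertex η m)
  have hb := inradius_bounds
  have hc := inradius_sq
  have hpos := cos_pi_div_ten_pos
  rw [vertex_add_label, inner_rotated, ha]
  rw [ha] at h2
  set p := (inner ℝ v (vertex η m) : ℝ)
  set q := (inner ℝ v (Complex.I * vertex η m) : ℝ)
  set y := (root a : ℂ).im
  have hlt : (y * q) ^ 2 < (inradius * p) ^ 2 := by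
    rw [mul_pow, mul_pow, show y ^ 2 = 1 - inradius ^ 2 by linarith,
      show q ^ 2 = 1 - p ^ 2 by linarith]
    nlinarith
  have h4 := sq_lt_sq.1 hlt
  rw [abs_of_neg (mul_neg_of_pos_of_neg inradius_pos (by linarith : p < 0))] at h4
  linarith [neg_abs_le (y * q)]

/-- The vertices `m ± 2` are at angle 3π/5 from the direction opposite to vertex `m`, so at least
π/2 from `v`. The bound is sharp: `1 - (inradius - 1 / 2) ^ 2` equals cos²(π/10), and on the
boundary of the sector the product can vanish. -/
lemma inner_nonpos_of_sector (hv : ‖v‖ = 1)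
    (hm : inner ℝ v (vertex η m) ≤ -Real.cos (Real.pi / 10)) {a : ZMod 5}
    (ha : (root a : ℂ).re = inradius - 1 / 2) : inner ℝ v (vertex η (m + a)) ≤ (0 : ℝ) := by
  have h1 := inner_sq_le hm
  have h2 := root_re_sq_add_im_sq a
  have h3 := inner_sq_add_inner_sq hv (norm_vertex η m)
  have hb := inradius_bounds
  have hc := inradius_sq
  have hpos := cos_pi_div_ten_pos
  rw [vertex_add_label, inner_rotated, ha]
  rw [ha] at h2
  set p := (inner ℝ v (vertex η m) : ℝ)
  set q := (inner ℝ v (Complex.I * vertex η m) : ℝ)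
  set y := (root a : ℂ).im
  have hle : (y * q) ^ 2 ≤ ((inradius - 1 / 2) * p) ^ 2 := by
    rw [mul_pow, mul_pow, show y ^ 2 = 1 - (inradius - 1 / 2) ^ 2 by linarith,
      show q ^ 2 = 1 - p ^ 2 by linarith]
    nlinarith
  have h4 := sq_le_sq.1 hle
  rw [abs_of_neg (mul_neg_of_pos_of_neg (by linarith) (by linarith : p < 0))] at h4
  linarith [le_abs_self (y * q)]

/-- A segment between two sides that would have to cross a diagonal in the wrong direction. -/
lemma no_pass {σ : ZMod 5} (hσ : σ = 1 ∨ σ = -1) {x : ℂ} {r : ℝ} (hr : 0 < r)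
    (hv : inner ℝ v (vertex η (m - 2 * σ)) ≤ (0 : ℝ)) (hx : x ∈ side η (m + σ))
    (hx' : x + (r : ℂ) * v ∈ side η (m + 2 * σ)) : ∃ j, x = vertex η j := by
  have hb := inradius_bounds
  -- Heights in the direction of vertex `m - 2σ`: the diagonal from `m` to `m + σ` is level at
  -- `inradius - 1 / 2`, the starting side lies at or below it and the final side at or above it. As
  -- the height does not increase along `v`, the start must be vertex `m`.
  have e1 : (inner ℝ (vertex η m) (vertex η (m - 2 * σ)) : ℝ) = inradius - 1 / 2 := by
    rw [inner_vertex]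
    rcases hσ with rfl | rfl
    · rw [show m - (m - 2 * 1) = 2 by ring, re_root_two]
    · rw [show m - (m - 2 * -1) = 3 by ring_nf; rfl, re_root_three]
  have e2 : (inner ℝ (vertex η (m + 2 * σ)) (vertex η (m - 2 * σ)) : ℝ) = -inradius := by
    rw [inner_vertex]
    rcases hσ with rfl | rfl
    · rw [show m + 2 * 1 - (m - 2 * 1) = 4 by ring, re_root_four]
    · rw [show m + 2 * -1 - (m - 2 * -1) = 1 by ring_nf; rfl, re_root_one]
  have e3 : (inner ℝ (vertex η (m + σ)) (vertex η (m - 2 * σ)) : ℝ) = inradius - 1 / 2 := by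
    rw [inner_vertex]
    rcases hσ with rfl | rfl
    · rw [show m + 1 - (m - 2 * 1) = 3 by ring, re_root_three]
    · rw [show m + -1 - (m - 2 * -1) = 2 by ring_nf; rfl, re_root_two]
  have s1 : x ∈ segment ℝ (vertex η m) (vertex η (m + 2 * σ)) := by
    rcases hσ with rfl | rfl
    · rw [side, show m + 1 - 1 = m by ring, show m + 1 + 1 = m + 2 * 1 by ring] at hx
      exact hx
    · rw [side, show m + -1 - 1 = m + 2 * -1 by ring, show m + -1 + 1 = m by ring] at hx
      rwa [segment_symm]
  have s2 : x + (r : ℂ) * v ∈ segment ℝ (vertex η (m + σ)) (vertex η (m - 2 * σ)) := by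
    rcases hσ with rfl | rfl
    · rw [side, show m + 2 * 1 - 1 = m + 1 by ring,
        show m + 2 * 1 + 1 = m - 2 * 1 by ring_nf; congr 1] at hx'
      exact hx'
    · rw [side, show m + 2 * -1 - 1 = m - 2 * -1 by ring_nf; congr 1,
        show m + 2 * -1 + 1 = m + -1 by ring] at hx'
      rwa [segment_symm]
  obtain ⟨a, b, ha, hb', hab, rfl⟩ := s1
  obtain ⟨a', b', ha', hb'', hab', he⟩ := s2
  have h := inner_add_mul (a • vertex η m + b • vertex η (m + 2 * σ)) v (vertex η (m - 2 * σ)) r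
  rw [← he, inner_add_left, inner_add_left, real_inner_smul_left, real_inner_smul_left,
    real_inner_smul_left, real_inner_smul_left, e1, e2, e3, inner_vertex_self] at h
  have h2 := mul_nonpos_of_nonneg_of_nonpos hr.le hv
  have h3 : a = 1 - b := by linarith
  have h4 : a' = 1 - b' := by linarith
  subst h3 h4
  have h5 : b * (2 * inradius - 1 / 2) ≤ 0 := by nlinarith
  have h6 : b = 0 := by
    by_contra h0
    have := mul_pos (lt_of_le_of_ne hb' (Ne.symm h0)) (by linarith : 0 < 2 * inradius - 1 / 2)
    linarith
  exact ⟨m, by simp [h6]⟩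

end Sector

/-! ### The total rotation in terms of the transitions -/

namespace Lift

variable {v : ℂ} {γ : ℝ → DoublePentagon} (A : Lift v γ) (ε₀ : ℤˣ)

/-- The label of the side on which the trajectory is at the next crossing. -/
def nextLabel (t : ℝ) : ZMod 5 := sideLabel γ (A.next t)

lemma pairCount_eq {L : ℝ} (hL0 : 0 < L) (hL : Function.Periodic γ L) (a b : ZMod 5)
    [DecidablePred fun t => sideLabel γ t = a ∧ A.nextLabel t = b] :
    pairCount γ L a b = ((A.finite_crossings_Ioc 0 L).toFinset.filter
      fun t => sideLabel γ t = a ∧ A.nextLabel t = b).card := by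
  have h1 : {t : ℝ | t ∈ Set.Ico 0 L ∧ OnSide (γ t) a ∧
      ∃ t' > t, OnSide (γ t') b ∧ ∀ r ∈ Set.Ioo t t', ∀ j, ¬ OnSide (γ r) j} =
      {t : ℝ | t ∈ Set.Ico 0 L ∧ (t ∈ crossings γ ∧ sideLabel γ t = a ∧ A.nextLabel t = b)} := by
    ext t
    refine and_congr_right fun _ => ⟨?_, ?_⟩
    · rintro ⟨ha, t', ht', hb, hr⟩
      refine ⟨⟨a, ha⟩, A.sideLabel_eq ha, ?_⟩
      rw [nextLabel, A.next_eq ht' ⟨b, hb⟩ fun r h1 h2 => not_exists.2 (hr r ⟨h1, h2⟩)]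
      exact A.sideLabel_eq hb
    · rintro ⟨hc, rfl, rfl⟩
      exact ⟨onSide_sideLabel hc, A.next t, A.lt_next t, onSide_sideLabel (A.next_mem t),
        fun r hr => not_exists.1 (A.not_mem_of_lt_next hr.1 hr.2)⟩
  have hp : ((0 : ℝ) ∈ crossings γ ∧ sideLabel γ 0 = a ∧ A.nextLabel 0 = b) ↔
      (L ∈ crossings γ ∧ sideLabel γ L = a ∧ A.nextLabel L = b) := by
    have e1 := crossings_periodic hL 0
    have e2 := sideLabel_periodic hL 0
    have e3 : A.nextLabel (0 + L) = A.nextLabel 0 := by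
      rw [nextLabel, A.next_periodic hL, sideLabel_periodic hL, nextLabel]
    rw [zero_add] at e1 e2 e3
    rw [e1, e2, e3]
  rw [pairCount, h1, ncard_Ico_eq_ncard_Ioc hL0 hp, ← Set.ncard_coe_finset]
  · congr 1
    ext t
    simp [and_assoc]
  · exact (A.finite_crossings_Ioc 0 L).subset fun t ht => ⟨⟨ht.1.1, ht.1.2.le⟩, ht.2.1⟩

-- An auxiliary function that is periodic along with the trajectory, so its jumps over a period sum
-- to zero. Subtracting them from the turns moves the turn at each exit from `η` to the preceding
-- entry.
open Classical in
lemma hasJumps_nextLabel (η : ℤˣ) (δ : ZMod 5) :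
    HasJumps (fun t => if A.εr t = η then δ * (2 * A.nextLabel t - 1) else 0)
      (fun t => if t ∈ crossings γ then
        (if A.εr t = η then δ * (2 * A.nextLabel t - 1) else -(δ * (2 * sideLabel γ t - 1)))
        else 0) := by
  intro t
  constructor
  · filter_upwards [A.right_step t, A.next_right t] with r h1 h2
    rw [h1.1, nextLabel, h2, nextLabel]
  · filter_upwards [A.left_step t, A.next_left t] with r h1 h2
    rw [h1.1]
    by_cases hc : t ∈ crossings γ
    · rw [if_pos hc, nextLabel, nextLabel, h2.1 hc, (A.cross hc).1]
      by_cases h : A.εl t = η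
      · rw [h, if_neg (neg_sign_ne _), if_neg (neg_sign_ne _), if_pos rfl]; ring
      · rw [eq_neg_of_ne h, neg_neg, if_pos rfl, if_neg (neg_sign_ne _), if_pos rfl]; ring
    · rw [if_neg hc, nextLabel, nextLabel, h2.2 hc, (A.eq_of_not_mem_crossings hc).1, add_zero]

/-- The total rotation during a period in terms of the transitions. -/
lemma rot_eq {L : ℝ} (hL0 : 0 < L) (hL : Function.Periodic γ L) {m : ZMod 5} {η : ℤˣ}
    (hm : inner ℝ v (vertex η m) ≤ -Real.cos (Real.pi / 10)) :
    A.rot ε₀ L = 2 * (if η = ε₀ then -1 else 1) *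
      ((pairCount γ L (m + 1) m : ZMod 5) + 3 * pairCount γ L (m + 1) (m - 2) -
        3 * pairCount γ L (m - 1) (m + 2) - pairCount γ L (m - 1) m) := by
  classical
  set δ : ZMod 5 := if η = ε₀ then -1 else 1 with hδ
  have hN := A.finite_crossings_Ioc 0 L
  have h1 := (A.hasJumps_rot ε₀).sub_eq hL0.le
  have h2 := (A.hasJumps_nextLabel η δ).sub_eq hL0.le
  have hper : A.εr L = A.εr 0 ∧ A.nextLabel L = A.nextLabel 0 := by
    constructor
    · simpa using (A.right_periodic hL).1 0
    · have : A.nextLabel (0 + L) = A.nextLabel 0 := by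
        rw [nextLabel, A.next_periodic hL, sideLabel_periodic hL, nextLabel]
      simpa using this
  rw [hper.1, hper.2, sub_self, jumpSum_ite _ hN] at h2
  have hj : A.jump ε₀ = fun t => if t ∈ crossings γ then turn ε₀ (A.εr t) (sideLabel γ t) else 0 :=
    rfl
  rw [rot_zero, sub_zero, hj, jumpSum_ite _ hN, ← sub_zero (Finset.sum _ _), h2,
    ← Finset.sum_sub_distrib] at h1
  rw [h1, A.pairCount_eq hL0 hL, A.pairCount_eq hL0 hL, A.pairCount_eq hL0 hL,
    A.pairCount_eq hL0 hL]
  simp only [Finset.card_filter, Nat.cast_sum, Nat.cast_ite, Nat.cast_one, Nat.cast_zero,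
    Finset.mul_sum, ← Finset.sum_add_distrib, ← Finset.sum_sub_distrib]
  refine Finset.sum_congr rfl fun t ht => ?_
  have hc : t ∈ crossings γ := (hN.mem_toFinset.1 ht).2
  have hneg1 : inner ℝ v (vertex η m) < (0 : ℝ) := by linarith [cos_pi_div_ten_pos]
  have hp1 := inner_pos_of_sector A.unit hm (a := 1) re_root_one
  have hp4 := inner_pos_of_sector A.unit hm (a := -1) (by rw [re_root_neg, re_root_one])
  have hp2 := inner_nonpos_of_sector A.unit hm (a := 2) re_root_two
  have hp3 := inner_nonpos_of_sector A.unit hm (a := -2) (by rw [re_root_neg, re_root_two])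
  -- A crossing into `η` now carries the contribution of the whole visit, and a crossing out of `η`
  -- carries none.
  by_cases h : A.εr t = η
  · have hturn : turn ε₀ (A.εr t) (sideLabel γ t) = δ * (2 * sideLabel γ t - 1) := by
      rw [turn, hδ, h]; split_ifs <;> ring
    rw [hturn, if_pos h]
    have hin := A.inner_pos hc
    obtain ⟨hf1, hf2⟩ := A.flight (A.lt_next t) fun s => A.not_mem_of_lt_next
    have hout := A.inner_neg (A.next_mem t)
    have hxs := A.right_mem_side hc
    have hxe := A.left_mem_side (A.next_mem t)
    have hvert := A.traj.ne_vertex (A.isAt_right t)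
    rw [hf1] at hout
    rw [hf1, hf2] at hxe
    rw [h] at hin hout hxs hxe hvert
    change inner ℝ v (vertex η (A.nextLabel t)) < 0 at hout
    change _ ∈ side η (A.nextLabel t) at hxe
    have hlt : 0 < A.next t - t := sub_pos.2 (A.lt_next t)
    have hent : sideLabel γ t = m + 1 ∨ sideLabel γ t = m + -1 := by
      have : ∀ j : ZMod 5, j = m + 1 ∨ j = m + -1 ∨ j = m ∨ j = m + 2 ∨ j = m + -2 := by
        clear * -; revert m; decide
      rcases this (sideLabel γ t) with e | e | e | e | e
      · exact Or.inl e
      · exact Or.inr e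
      all_goals rw [e] at hin; exact absurd hin (by linarith)
    have hex : A.nextLabel t = m ∨ A.nextLabel t = m + 2 ∨ A.nextLabel t = m + -2 := by
      have : ∀ j : ZMod 5, j = m + 1 ∨ j = m + -1 ∨ j = m ∨ j = m + 2 ∨ j = m + -2 := by
        clear * -; revert m; decide
      rcases this (A.nextLabel t) with e | e | e | e | e
      · rw [e] at hout; exact absurd hout (by linarith)
      · rw [e] at hout; exact absurd hout (by linarith)
      all_goals simp [e]
    have no1 : sideLabel γ t = m + 1 → A.nextLabel t ≠ m + 2 := by
      intro e1 e2
      rw [e1] at hxs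
      rw [e2] at hxe
      obtain ⟨j, hj⟩ := no_pass (σ := 1) (Or.inl rfl) hlt (by simpa [sub_eq_add_neg] using hp3) hxs
        (by simpa using hxe)
      exact hvert j hj
    have no2 : sideLabel γ t = m + -1 → A.nextLabel t ≠ m + -2 := by
      intro e1 e2
      rw [e1] at hxs
      rw [e2] at hxe
      obtain ⟨j, hj⟩ := no_pass (σ := -1) (Or.inr rfl) hlt (by simpa using hp2) hxs
        (by simpa using hxe)
      exact hvert j hj
    -- With entry `j` and exit `b`, the term is `2 * δ * (j - b)`; only the four counted pairs
    -- remain.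
    clear_value δ
    generalize sideLabel γ t = j at hent no1 no2 ⊢
    generalize A.nextLabel t = b at hex no1 no2 ⊢
    clear * - hent hex no1 no2
    revert m j b δ
    decide
  · have hη : A.εr t = -η := eq_neg_of_ne h
    have hturn : turn ε₀ (A.εr t) (sideLabel γ t) = -(δ * (2 * sideLabel γ t - 1)) := by
      rw [turn, hδ, hη]
      by_cases h3 : η = ε₀
      · rw [h3, if_neg (neg_sign_ne _), if_pos rfl]; ring
      · rw [if_neg h3, eq_neg_of_ne h3, neg_neg, if_pos rfl]; ring
    have hin := A.inner_pos hc
    rw [hη, vertex_neg, inner_neg_right] at hin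
    -- Entering `-η` through `m ± 1` would go against the direction of `v`, so these crossings are
    -- in none of the four counts.
    have hno1 : sideLabel γ t ≠ m + 1 := fun e => by rw [e] at hin; linarith
    have hno2 : sideLabel γ t ≠ m - 1 := fun e => by
      rw [e, sub_eq_add_neg] at hin; linarith
    rw [hturn, if_neg h]
    simp [hno1, hno2]

end Lift

end Pentagon

end

/-! ### The least even period -/

open Pentagon in
theorem theorem9 (v : ℂ) (hv : ‖v‖ = 1) (m : ZMod 5) (hm : v ∈ sector m)
    (γ : ℝ → DoublePentagon) (hγ : IsLinearTrajectory v γ)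
    (L : ℝ) (hL : IsLeast {T : ℝ | 0 < T ∧ Function.Periodic γ T} L)
    (c d e f : ℕ) (hcount : countVector m γ L = ![c, d, e, f])
    (ε : ℤˣ) (z : ℂ) (hz : ∀ᶠ r in 𝓝[≥] (0 : ℝ), IsAt (γ r) ε (z + (r : ℂ) * v)) :
    (∃ β : ℝ → ℂ, IsBilliardTrajectory ε β ∧ ∀ᶠ r in 𝓝[≥] (0 : ℝ), β r = z + (r : ℂ) * v) ∧
    ∀ β : ℝ → ℂ, IsBilliardTrajectory ε β →
      (∀ᶠ r in 𝓝[≥] (0 : ℝ), β r = z + (r : ℂ) * v) →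
      (((c : ℤ) - f) + 2 * ((e : ℤ) - d) ≡ 0 [ZMOD 5] → IsLeast {T | IsEvenPeriod ε β T} L) ∧
      (¬ ((c : ℤ) - f) + 2 * ((e : ℤ) - d) ≡ 0 [ZMOD 5] →
        IsLeast {T | IsEvenPeriod ε β T} (5 * L)) := by
  obtain ⟨A⟩ := hγ.exists_lift hv
  obtain ⟨⟨hL0, hLp⟩, hLmin⟩ := hL
  have hz0 : RightGerm v γ 0 ε z := by
    simpa [RightGerm] using hz
  obtain ⟨hε, hx⟩ := A.right_unique hz0
  have hβ0 : A.billiard ε 0 = z := by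
    rw [Lift.billiard, hε, hx, A.rot_zero, fold_self, root_zero]; simp
  have hgerm : ∀ᶠ r in 𝓝[≥] (0 : ℝ), A.billiard ε r = z + (r : ℂ) * v := by
    refine eventually_nonneg_of_pos (by simp [hβ0]) ?_
    filter_upwards [A.billiard_right ε 0] with r hr
    rw [zero_add, hβ0, hε, A.rot_zero, fold_self, root_zero] at hr
    simpa using hr
  refine ⟨⟨A.billiard ε, A.isBilliardTrajectory ε, hgerm⟩, fun β hβ hβg => ?_⟩
  have hβ_eq : β = A.billiard ε := by
    refine hβ.unique (A.isBilliardTrajectory ε) ?_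
    filter_upwards [(hβg.and hgerm).filter_mono (nhdsWithin_mono 0 Set.Ioi_subset_Ici_self)]
      with r hr
    rw [hr.1, hr.2]
  subst hβ_eq
  have hW : A.rot ε L = 0 ↔ ((c : ℤ) - f) + 2 * ((e : ℤ) - d) ≡ 0 [ZMOD 5] := by
    -- The sector fixes `v` only up to sign; the sign decides in which pentagon `v` points towards
    -- side `m`.
    obtain ⟨η, hη⟩ : ∃ η, inner ℝ v (vertex η m) ≤ -Real.cos (Real.pi / 10) := by
      rcases le_abs.1 (show Real.cos (Real.pi / 10) ≤ |inner ℝ v (V m)| from hm) with h | h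
      · refine ⟨-1, ?_⟩
        rw [vertex_neg, inner_neg_right]
        simpa [vertex] using h
      · refine ⟨1, ?_⟩
        have : vertex 1 m = V m := by simp [vertex]
        rw [this]
        linarith
    have h := A.rot_eq ε hL0 hLp hη
    have h0 := congrFun hcount 0
    have h1 := congrFun hcount 1
    have h2 := congrFun hcount 2
    have h3 := congrFun hcount 3
    simp only [countVector, Matrix.cons_val] at h0 h1 h2 h3
    rw [h0, h1, h2, h3] at h
    have hmod : ((c : ℤ) - f) + 2 * ((e : ℤ) - d) ≡ 0 [ZMOD 5] ↔
        (((c : ℤ) - f + 2 * ((e : ℤ) - d) : ℤ) : ZMod 5) = ((0 : ℤ) : ZMod 5) :=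
      (ZMod.intCast_eq_intCast_iff _ _ 5).symm
    rw [h, hmod]
    push_cast
    generalize (c : ZMod 5) = c'
    generalize (d : ZMod 5) = d'
    generalize (e : ZMod 5) = e'
    generalize (f : ZMod 5) = f'
    -- Both signs give a unit multiple of the stated combination, since 2 is invertible modulo 5.
    clear * -
    split_ifs <;> revert c' d' e' f' <;> decide
  have hmul : ∀ T, IsEvenPeriod ε (A.billiard ε) T →
      ∃ n : ℕ, 0 < n ∧ T = n * L ∧ (n : ZMod 5) * A.rot ε L = 0 := by
    intro T hT
    obtain ⟨hp, hr⟩ := A.periodic_of_isEvenPeriod ε hT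
    have hn := Nat.floor_le (div_nonneg hT.1.le hL0.le)
    have hn' := Nat.lt_floor_add_one (T / L)
    set n := ⌊T / L⌋₊
    rw [le_div_iff₀ hL0] at hn
    rw [div_lt_iff₀ hL0] at hn'
    have hTn : T = n * L := by
      by_contra hne
      have hlt : (n : ℝ) * L < T := lt_of_le_of_ne hn (Ne.symm hne)
      -- Otherwise the remainder of `T` modulo `L` would be a positive period smaller than `L`.
      have := hLmin (show T - n * L ∈ {T : ℝ | 0 < T ∧ Function.Periodic γ T} from
        ⟨sub_pos.2 hlt, hp.sub_period (hLp.nat_mul n)⟩)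
      linarith
    refine ⟨n, ?_, hTn, ?_⟩
    · rcases Nat.eq_zero_or_pos n with h | h
      · rw [hTn, h] at hT
        simpa using hT.1
      · exact h
    · rw [← A.rot_nat_mul ε hLp, ← hTn, hr]
  constructor
  · intro h
    refine ⟨A.isEvenPeriod_of_periodic ε hL0 hLp (hW.2 h), fun T hT => ?_⟩
    obtain ⟨n, hn, rfl, -⟩ := hmul T hT
    have : (1 : ℝ) ≤ n := by exact_mod_cast hn
    nlinarith
  · intro h
    have h5 : A.rot ε (5 * L) = 0 := by
      have := A.rot_nat_mul ε hLp 5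
      push_cast at this
      rw [this, show (5 : ZMod 5) = 0 from rfl, zero_mul]
    refine ⟨A.isEvenPeriod_of_periodic ε (by linarith) ?_ h5, fun T hT => ?_⟩
    · simpa using hLp.nat_mul 5
    · obtain ⟨n, hn, rfl, hnW⟩ := hmul T hT
      have : Fact (Nat.Prime 5) := ⟨by norm_num⟩
      have h6 : (n : ZMod 5) = 0 := (mul_eq_zero.1 hnW).resolve_right (mt hW.1 h)
      have h7 : 5 ≤ n := Nat.le_of_dvd hn ((ZMod.natCast_eq_zero_iff n 5).1 h6)
      have : (5 : ℝ) ≤ n := by exact_mod_cast h7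
      nlinarith
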